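/- For real numbers $b<a$, the promise problem $(a,b)$-Gap $\mathsf{SP}_3$ is the following. The input is an integer $n\ge 1$ and a collection $\mathcal S$ of $3$-element subsets of $[n]$. Accept if some subcollection of pairwise disjoint sets of $\mathcal S$ covers at least $an$ elements of $[n]$. Reject if every subcollection of pairwise disjoint sets of $\mathcal S$ covers at most $bn$ elements. In Euclidean DST (the discrete Steiner tree problem) the input is a nonempty finite set $P$ of terminals and a finite set $X$ of facilities in some $\mathbb R^d$, with rational coordinates, where $|X|$ is bounded by a fixed polynomial in $|P|$. A Steiner tree is a tree with vertex set $P\cup S$ for some $S\subseteq X$. Its cost is the sum of the Euclidean lengths of its edges, and $\mathrm{OPT}(P,X)$ is the minimum cost. A promise problem is NP-hard if every language in NP has a polynomial-time many-one reduction to it. Euclidean DST is NP-hard to approximate within a factor $\gamma$ if its gap version with factor $\gamma$ is NP-hard, that is, if for some fixed polynomial bound on $|X|$ and some fixed real unit $\kappa>0$ the following promise problem is NP-hard: given $(P,X)$ and a positive rational $q$, accept if $\mathrm{OPT}(P,X)\le \kappa q$ and reject if $\mathrm{OPT}(P,X)\ge\gamma\kappa q$. The following hold. 1. Let $b<a$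 be real numbers. If $(a,b)$-Gap $\mathsf{SP}_3$ is NP-hard, then Euclidean DST is NP-hard to approximate within a factor of $$\frac{b\,(5\sqrt3/9-1)+1}{a\,(5\sqrt3/9-1)+1}.$$ 2. Let $\varepsilon>0$. If $(1,1-\varepsilon)$-Gap $\mathsf{SP}_3$ is NP-hard, then Euclidean DST is NP-hard to approximate within a factor of $$1+\frac{\varepsilon(9\sqrt3-15)}{15}\ \ge\ 1+0.039\,\varepsilon .$$ 3. If $(0.979,0.969)$-Gap $\mathsf{SP}_3$ is NP-hard (the bounds of Chlebík and Chlebíková), then Euclidean DST is NP-hard to approximate within a factor of $1.00039$. -/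

import Mathlib

/-! ### Polynomial time, NP and NP-hardness of promise problems

Polynomial time is polynomially many steps of a multi-stack Turing machine (`Turing.FinTM2`). -/

/-- The class NP: `L` has a polynomial-time verifier `V` and witnesses of polynomial length.
A pair `(x, w)` is given to the verifier as `x`, a separator, `w`. -/
def InNP (L : Set (List Bool)) : Prop :=
  ∃ (V : List Bool × List Bool → Bool) (p : Polynomial ℕ),
    Nonempty (Turing.TM2ComputableInPolyTime
      (fun xw : List Bool × List Bool => xw.1.map some ++ none :: xw.2.map some)
      Computability.encodeBool V) ∧
    ∀ x, x ∈ L ↔ ∃ w : List Bool, w.length ≤ p.eval x.length ∧ V (x, w) = true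

/-- The finite alphabet in which instances are written. -/
inductive Letter
  | bit (b : Bool)
  | minus
  | slash
  | comma
  | semi
  | hash
deriving DecidableEq, Fintype

/-- A promise problem: instances, an unambiguous way of writing them as words, and the instances
which have to be accepted and rejected (on all others any answer is allowed). -/
structure PromiseProblem where
  Inst : Type
  encode : Inst → List Letter
  encode_injective : Function.Injective encode
  yes : Set Inst
  no : Set Inst

/-- NP-hardness: every language in NP has a polynomial-time many-one reduction to the problem. -/
def PromiseProblem.NPHard (Q : PromiseProblem) : Prop :=
  ∀ L : Set (List Bool), InNP L →
    ∃ f : List Bool → Q.Inst,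
      Nonempty (Turing.TM2ComputableInPolyTime (fun x : List Bool => x) Q.encode f) ∧
      (∀ x, x ∈ L → f x ∈ Q.yes) ∧ (∀ x, x ∉ L → f x ∈ Q.no)

/-! ### Set packing with sets of size three -/

/-- A set system over the universe `[n]`, `n ≥ 1`: a collection of distinct sets of size three,
presented by a list. -/
structure SetSystem3 where
  n : ℕ
  n_pos : 0 < n
  sets : List (Finset (Fin n))
  nodup : sets.Nodup
  card_eq : ∀ S ∈ sets, S.card = 3

/-- `C` is a subcollection of pairwise disjoint sets of the system. -/
def SetSystem3.IsPacking (I : SetSystem3) (C : Finset (Finset (Fin I.n))) : Prop :=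
  C ⊆ I.sets.toFinset ∧ (C : Set (Finset (Fin I.n))).PairwiseDisjoint id

/-- The number of elements of the universe covered by a collection of sets. -/
def coverage {n : ℕ} (C : Finset (Finset (Fin n))) : ℕ := (C.biUnion id).card

/-- A set system is written as `n` in unary, followed by the 0-1 incidence vectors of its sets. -/
def SetSystem3.encode (I : SetSystem3) : List Letter :=
  List.replicate I.n (Letter.bit true) ++ Letter.hash ::
    I.sets.flatMap (fun S => (List.ofFn fun i => Letter.bit (decide (i ∈ S))) ++ [Letter.semi])

/-! ### The discrete Steiner tree problem in Euclidean space -/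

/-- An instance of Euclidean DST: a nonempty finite set of terminals and a finite set of facilities
in `ℝ^dim`, with rational coordinates, each presented by a list without repetitions. -/
structure DSTInstance where
  dim : ℕ
  terminals : List (Fin dim → ℚ)
  facilities : List (Fin dim → ℚ)
  terminals_ne_nil : terminals ≠ []
  terminals_nodup : terminals.Nodup
  facilities_nodup : facilities.Nodup

/-- A rational point as a point of Euclidean space. -/
noncomputable def euclPoint {d : ℕ} (v : Fin d → ℚ) : EuclideanSpace ℝ (Fin d) :=
  WithLp.toLp 2 (fun i => (v i : ℝ))

/-- A Steiner tree of the terminals `P` with Steiner points `steiner ⊆ X`: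
a tree with vertex set `P ∪ steiner`. -/
structure SteinerTree {d : ℕ} (P X : Finset (Fin d → ℚ)) where
  steiner : Finset (Fin d → ℚ)
  steiner_subset : steiner ⊆ X
  graph : SimpleGraph ↥(P ∪ steiner)
  isTree : graph.IsTree

open Classical in
/-- The cost of a Steiner tree: the sum of the Euclidean lengths of its edges. -/
noncomputable def SteinerTree.cost {d : ℕ} {P X : Finset (Fin d → ℚ)} (T : SteinerTree P X) : ℝ :=
  ∑ e ∈ T.graph.edgeFinset,
    Sym2.lift ⟨fun u v : ↥(P ∪ T.steiner) => dist (euclPoint u.1) (euclPoint v.1),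
      fun _ _ => dist_comm _ _⟩ e

/-- The Steiner trees that are admissible for an instance of DST. -/
abbrev DSTInstance.Tree (I : DSTInstance) : Type :=
  SteinerTree I.terminals.toFinset I.facilities.toFinset

/-- A rational number is written as its sign, numerator and denominator, both in binary. -/
def encodeRat (q : ℚ) : List Letter :=
  (if q < 0 then [Letter.minus] else []) ++ q.num.natAbs.bits.map Letter.bit ++
    Letter.slash :: q.den.bits.map Letter.bit

/-- A list of rational points is written coordinate by coordinate. -/
def encodePoints {d : ℕ} (l : List (Fin d → ℚ)) : List Letter :=
  l.flatMap fun v => ((List.ofFn v).flatMap fun q => encodeRat q ++ [Letter.comma]) ++ [Letter.semi]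

/-- An instance of DST together with a rational number: the dimension in unary, the terminals,
the facilities, and the number. -/
def encodeDST (J : DSTInstance × {q : ℚ // 0 < q}) : List Letter :=
  List.replicate J.1.dim (Letter.bit true) ++ Letter.hash ::
    (encodePoints J.1.terminals ++ Letter.hash ::
      (encodePoints J.1.facilities ++ Letter.hash :: encodeRat J.2.1))

/-! ### The encodings are unambiguous -/

theorem append_sep_inj {β : Type} {sep : β} {u u' r r' : List β} (hu : sep ∉ u) (hu' : sep ∉ u')
    (h : u ++ sep :: r = u' ++ sep :: r') : u = u' ∧ r = r' := by
  induction u generalizing u' with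
  | nil =>
    cases u' with
    | nil => simpa using h
    | cons b t =>
      simp only [List.nil_append, List.cons_append, List.cons.injEq] at h
      exact absurd (h.1 ▸ List.mem_cons_self) hu'
  | cons a s ih =>
    cases u' with
    | nil =>
      simp only [List.nil_append, List.cons_append, List.cons.injEq] at h
      exact absurd (h.1 ▸ List.mem_cons_self) hu
    | cons b t =>
      simp only [List.cons_append, List.cons.injEq] at h
      obtain ⟨h1, h2⟩ := ih (fun hm => hu (List.mem_cons_of_mem _ hm))
        (fun hm => hu' (List.mem_cons_of_mem _ hm)) h.2
      exact ⟨by rw [h.1, h1], h2⟩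

theorem flatMap_sep_inj {α β : Type} {sep : β} {w : α → List β} (hw : ∀ a, sep ∉ w a)
    (hinj : Function.Injective w) :
    Function.Injective fun l : List α => l.flatMap fun a => w a ++ [sep] := by
  intro l
  induction l with
  | nil => intro l' h; cases l' <;> simp_all
  | cons a s ih =>
    intro l' h
    cases l' with
    | nil => simp at h
    | cons b t =>
      simp only [List.flatMap_cons, List.append_assoc, List.cons_append, List.nil_append] at h
      obtain ⟨h1, h2⟩ := append_sep_inj (hw a) (hw b) h
      rw [hinj h1, ih h2]

theorem map_bit_bits_inj {m n : ℕ} (h : m.bits.map Letter.bit = n.bits.map Letter.bit) : m = n := by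
  have h' : m.bits = n.bits :=
    List.map_injective_iff.mpr (fun a b hab => by simpa using hab) h
  rw [← Nat.digits_inj_iff (b := 2), Nat.digits_two_eq_bits, Nat.digits_two_eq_bits, h']

theorem encodeRat_injective : Function.Injective encodeRat := by
  intro p q h
  have key : (p < 0 ↔ q < 0) ∧ p.num.natAbs = q.num.natAbs ∧ p.den = q.den := by
    unfold encodeRat at h
    obtain ⟨h1, h2⟩ := append_sep_inj (by split_ifs <;> simp) (by split_ifs <;> simp) h
    refine ⟨?_, ?_, map_bit_bits_inj h2⟩
    · split_ifs at h1 with hp hq hq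
      · simp [hp, hq]
      · exfalso
        have : Letter.minus ∈ [] ++ q.num.natAbs.bits.map Letter.bit := by rw [← h1]; simp
        simp at this
      · exfalso
        have : Letter.minus ∈ [] ++ p.num.natAbs.bits.map Letter.bit := by rw [h1]; simp
        simp at this
      · simp [hp, hq]
    · split_ifs at h1 with hp hq hq
      · exact map_bit_bits_inj (by simpa using h1)
      · exfalso
        have : Letter.minus ∈ [] ++ q.num.natAbs.bits.map Letter.bit := by rw [← h1]; simp
        simp at this
      · exfalso
        have : Letter.minus ∈ [] ++ p.num.natAbs.bits.map Letter.bit := by rw [h1]; simp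
        simp at this
      · exact map_bit_bits_inj (by simpa using h1)
  obtain ⟨h1, h2, h3⟩ := key
  refine Rat.ext ?_ h3
  rw [← Rat.num_neg, ← Rat.num_neg] at h1
  omega

theorem not_mem_encodeRat {s : Letter} (h1 : ∀ b, s ≠ Letter.bit b) (h2 : s ≠ Letter.minus)
    (h3 : s ≠ Letter.slash) (q : ℚ) : s ∉ encodeRat q := by
  unfold encodeRat
  split_ifs <;> simp [h2, h3] <;> exact ⟨⟨fun _ => (h1 _).symm, fun _ => (h1 _).symm⟩,
    ⟨fun _ => (h1 _).symm, fun _ => (h1 _).symm⟩⟩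

theorem encodePoints_injective {d : ℕ} :
    Function.Injective (encodePoints (d := d)) := by
  refine flatMap_sep_inj (sep := Letter.semi)
    (w := fun v : Fin d → ℚ => (List.ofFn v).flatMap fun q => encodeRat q ++ [Letter.comma]) ?_ ?_
  · intro v hv
    simp only [List.mem_flatMap, List.mem_append] at hv
    obtain ⟨q, -, hq | hq⟩ := hv
    · exact not_mem_encodeRat (by simp) (by simp) (by simp) q hq
    · simp at hq
  · intro v w h
    exact List.ofFn_injective (flatMap_sep_inj (sep := Letter.comma)
      (fun q => not_mem_encodeRat (by simp) (by simp) (by simp) q) encodeRat_injective h)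

theorem hash_not_mem_encodePoints {d : ℕ} (l : List (Fin d → ℚ)) :
    Letter.hash ∉ encodePoints l := by
  intro h
  simp only [encodePoints, List.mem_flatMap, List.mem_append] at h
  obtain ⟨v, -, ⟨q, -, hq | hq⟩ | h⟩ := h
  · exact not_mem_encodeRat (by simp) (by simp) (by simp) q hq
  · simp at hq
  · simp at h

theorem SetSystem3.encode_injective : Function.Injective SetSystem3.encode := by
  rintro ⟨n, hn, l, h1, h2⟩ ⟨n', hn', l', h1', h2'⟩ h
  obtain ⟨ha, hb⟩ := append_sep_inj (by simp) (by simp) h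
  obtain rfl : n = n' := by simpa using congrArg List.length ha
  obtain rfl : l = l' := by
    refine flatMap_sep_inj (sep := Letter.semi)
      (w := fun S : Finset (Fin n) => List.ofFn fun i => Letter.bit (decide (i ∈ S)))
      (by simp [List.mem_ofFn]) ?_ hb
    intro S T hST
    have := List.ofFn_injective hST
    ext i
    simpa using congrFun this i
  rfl

theorem encodeDST_injective : Function.Injective encodeDST := by
  rintro ⟨⟨d, P, X, h1, h2, h3⟩, q⟩ ⟨⟨d', P', X', h1', h2', h3'⟩, q'⟩ h
  obtain ⟨ha, hb⟩ := append_sep_inj (by simp) (by simp) h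
  obtain rfl : d = d' := by simpa using congrArg List.length ha
  obtain ⟨hP, hc⟩ := append_sep_inj (hash_not_mem_encodePoints _) (hash_not_mem_encodePoints _) hb
  obtain ⟨hX, hq⟩ := append_sep_inj (hash_not_mem_encodePoints _) (hash_not_mem_encodePoints _) hc
  obtain rfl := encodePoints_injective hP
  obtain rfl := encodePoints_injective hX
  obtain rfl := Subtype.ext (encodeRat_injective hq)
  rfl

/-! ### The two gap problems -/

/-- `(a, b)`-Gap `SP₃`: distinguish set systems with a packing that covers at least `a n` elements
from those in which every packing covers at most `b n` elements. -/
def gapSP3 (a b : ℝ) : PromiseProblem where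
  Inst := SetSystem3
  encode := SetSystem3.encode
  encode_injective := SetSystem3.encode_injective
  yes := {I | ∃ C, I.IsPacking C ∧ a * (I.n : ℝ) ≤ (coverage C : ℝ)}
  no := {I | ∀ C, I.IsPacking C → (coverage C : ℝ) ≤ b * (I.n : ℝ)}

/-- The gap version of Euclidean DST with factor `γ`. The input is an instance `(P, X)` with
`|X| ≤ p(|P|)` and a positive rational `q`, which is the budget in the fixed unit `κ`. The problem
is to distinguish optimal cost at most `κ q` from optimal cost at least `γ κ q`. -/
def gapDST (p : Polynomial ℕ) (κ γ : ℝ) : PromiseProblem where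
  Inst := DSTInstance × {q : ℚ // 0 < q}
  encode := encodeDST
  encode_injective := encodeDST_injective
  yes := {J | J.1.facilities.length ≤ p.eval J.1.terminals.length ∧
    ∃ T : J.1.Tree, T.cost ≤ κ * (J.2.1 : ℝ)}
  no := {J | J.1.facilities.length ≤ p.eval J.1.terminals.length ∧
    ∀ T : J.1.Tree, γ * (κ * (J.2.1 : ℝ)) ≤ T.cost}

/-- Euclidean DST, with polynomially many facilities, is NP-hard to approximate within `γ`: its gap
version with factor `γ` is NP-hard. The real unit `κ > 0` is fixed once and for all; it is there
because costs are sums of square roots, so that a threshold need not be rational. -/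
def EuclideanDSTHardToApprox (γ : ℝ) : Prop :=
  ∃ (p : Polynomial ℕ) (κ : ℝ), 0 < κ ∧ (gapDST p κ γ).NPHard

/-! ### Rooted trees and parent functions -/

/-! A set system on `[n]` becomes the instance with terminals the origin and the unit vectors e_i,
and with one facility (1/6)·1_S for each set S. Joining e_i to the origin costs 1. Joining the three
elements of S through the facility costs 3·√3/2 + √3/6 = 5√3/3 instead of 3, a saving of `saving` =
1 - 5√3/9 per element; the height 1/6 minimises 3·√((1-t)² + 2t²) + √3·t over t. The optimum is
therefore n - `saving`·(maximum coverage by a packing), and a gap in coverage becomes a gap in cost.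

The upper bound (`SetSystem3.IsPacking.exists_steinerTree`) is the star just described. For the
lower bound (`SteinerTree.exists_isPacking`), root the tree at the origin and let every vertex pay
for the edge to its parent. Charge each element lying in some used facility to such a facility
nearest to the root, and let K be the set of elements charged to S. A parent facility contains no
element of K, which keeps it away from S. By `card_le_dist_centerPt`, the edge above S then pays for
all that K can save, unless K = S, when the net saving is at most 3·`saving`. The sets with K = S
are pairwise disjoint: they are the required packing.

For hardness the map must be computed in polynomial time and composed with a given reduction.
`Turing.TM2ComputableInPolyTime.comp` composes stack machines, and `reduce_computable` supplies an
explicit machine. The budget is q = n, in the unit κ = 1 - a·`saving` when a ≤ 1. -/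

theorem SimpleGraph.Connected.exists_adj_dist_lt {V : Type*} {G : SimpleGraph V}
    (hG : G.Connected) {r v : V} (hv : v ≠ r) : ∃ u, G.Adj v u ∧ G.dist r u < G.dist r v := by
  obtain ⟨p, hp⟩ := hG.exists_walk_length_eq_dist v r
  cases p with
  | nil => exact absurd rfl hv
  | cons h q =>
    refine ⟨_, h, ?_⟩
    rw [G.dist_comm (u := r) (v := v), ← hp, G.dist_comm]
    exact lt_of_le_of_lt (SimpleGraph.dist_le q) (by simp)

/-- In a connected graph, the edges from the vertices to parents closer to the root are distinct. -/
theorem SimpleGraph.Connected.exists_parent_sum_le {V : Type*} [Fintype V] [DecidableEq V]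
    {G : SimpleGraph V} [Fintype G.edgeSet] (hG : G.Connected) (r : V) (w : Sym2 V → ℝ)
    (hw : ∀ e, 0 ≤ w e) :
    ∃ par : V → V, (∀ v, v ≠ r → G.dist r (par v) < G.dist r v) ∧
      ∑ v ∈ Finset.univ.erase r, w s(v, par v) ≤ ∑ e ∈ G.edgeFinset, w e := by
  choose! par hadj hlt using fun (v : V) (hv : v ≠ r) => hG.exists_adj_dist_lt hv
  refine ⟨par, hlt, ?_⟩
  -- Two vertices sharing such an edge would be parents of each other, each strictly nearer to the
  -- root than the other.
  have hinj : Set.InjOn (fun v => s(v, par v)) (Finset.univ.erase r : Finset V) := by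
    intro u hu v hv h
    have hu' : u ≠ r := by simpa using hu
    have hv' : v ≠ r := by simpa using hv
    rcases Sym2.eq_iff.mp h with ⟨h1, -⟩ | ⟨h1, h2⟩
    · exact h1
    · have h3 := hlt u hu'
      have h4 := hlt v hv'
      rw [h2] at h3
      rw [← h1] at h4
      omega
  rw [← Finset.sum_image (f := w) hinj]
  refine Finset.sum_le_sum_of_subset_of_nonneg ?_ fun e _ _ => hw e
  intro e he
  obtain ⟨v, hv, rfl⟩ := Finset.mem_image.mp he
  rw [SimpleGraph.mem_edgeFinset, SimpleGraph.mem_edgeSet]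
  exact hadj v (Finset.ne_of_mem_erase hv)

/-- A parent function along which a depth decreases is the parent function of a rooted tree. -/
theorem SimpleGraph.exists_isTree_of_parent {V : Type*} [Fintype V] [DecidableEq V] (r : V)
    (par : V → V) (depth : V → ℕ) (h : ∀ v, v ≠ r → depth (par v) < depth v) (w : Sym2 V → ℝ)
    (hw : ∀ e, 0 ≤ w e) :
    ∃ G : SimpleGraph V, G.IsTree ∧ ∀ [Fintype G.edgeSet],
      ∑ e ∈ G.edgeFinset, w e ≤ ∑ v ∈ Finset.univ.erase r, w s(v, par v) := by
  let G : SimpleGraph V := SimpleGraph.fromRel fun u v => u ≠ r ∧ par u = v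
  have hsub : ∀ e ∈ G.edgeSet, e ∈ (Finset.univ.erase r).image fun v => s(v, par v) := by
    intro e
    induction e with
    | h u v =>
      intro he
      rw [SimpleGraph.mem_edgeSet, SimpleGraph.fromRel_adj] at he
      rw [Finset.mem_image]
      rcases he with ⟨-, ⟨h1, rfl⟩ | ⟨h1, rfl⟩⟩
      · exact ⟨u, by simp [h1], rfl⟩
      · exact ⟨v, by simp [h1], Sym2.eq_swap⟩
  have hreach : ∀ n v, depth v = n → G.Reachable v r := by
    intro n
    induction n using Nat.strong_induction_on with
    | _ n ih =>
      intro v hv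
      by_cases hr : v = r
      · rw [hr]
      · have hlt := h v hr
        have hadj : G.Adj v (par v) := by
          rw [SimpleGraph.fromRel_adj]
          exact ⟨fun he => by rw [← he] at hlt; exact lt_irrefl _ hlt, Or.inl ⟨hr, rfl⟩⟩
        exact hadj.reachable.trans (ih _ (hv ▸ hlt) _ rfl)
  have hconn : G.Connected :=
    { preconnected := fun u v => (hreach _ u rfl).trans (hreach _ v rfl).symm
      nonempty := ⟨r⟩ }
  refine ⟨G, ?_, ?_⟩
  · classical
    rw [SimpleGraph.isTree_iff_connected_and_card]
    -- Every edge comes from a non-root vertex, so there are at most |V| - 1 edges, and a connected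
    -- graph with so few edges is a tree.
    refine ⟨hconn, le_antisymm ?_ hconn.card_vert_le_card_edgeSet_add_one⟩
    have h1 : Nat.card G.edgeSet ≤ (Finset.univ.erase r).card := by
      rw [Nat.card_eq_fintype_card, ← SimpleGraph.edgeFinset_card]
      refine (Finset.card_le_card fun e he => hsub e ?_).trans Finset.card_image_le
      simpa using he
    rw [Finset.card_erase_of_mem (Finset.mem_univ r), Finset.card_univ] at h1
    have h2 : 0 < Fintype.card V := Fintype.card_pos_iff.mpr ⟨r⟩
    rw [Nat.card_eq_fintype_card (α := V)]
    omega
  · intro _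
    refine le_trans (Finset.sum_le_sum_of_subset_of_nonneg
      (fun e he => hsub e (by simpa using he)) fun e _ _ => hw e) ?_
    exact Finset.sum_image_le_of_nonneg fun v _ => hw _

/-! ### Distances between terminals and facilities -/

/-- The saving per covered element. -/
noncomputable def saving : ℝ := 1 - 5 * Real.sqrt 3 / 9

theorem saving_pos : 0 < saving := by
  have h := Real.sq_sqrt (show (0 : ℝ) ≤ 3 by norm_num)
  have h0 := Real.sqrt_nonneg 3
  unfold saving
  nlinarith

theorem saving_lt_one : saving < 1 := by
  have h0 : 0 < Real.sqrt 3 := by positivity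
  unfold saving
  linarith

/-- The unit vector of an element of the universe. -/
def unitPt {n : ℕ} (i : Fin n) : Fin n → ℚ := fun j => if j = i then 1 else 0

/-- The facility of a set. -/
def centerPt {n : ℕ} (S : Finset (Fin n)) : Fin n → ℚ := fun j => if j ∈ S then 1 / 6 else 0

/-- The square of the Euclidean distance. -/
def sqDist {n : ℕ} (u v : Fin n → ℚ) : ℚ := ∑ i, (u i - v i) ^ 2

theorem dist_euclPoint {n : ℕ} (u v : Fin n → ℚ) :
    dist (euclPoint u) (euclPoint v) = Real.sqrt (sqDist u v : ℝ) := by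
  rw [EuclideanSpace.dist_eq]
  congr 1
  rw [sqDist]
  push_cast
  refine Finset.sum_congr rfl fun i _ => ?_
  rw [Real.dist_eq, sq_abs]
  rfl

theorem le_dist_euclPoint {n : ℕ} {u v : Fin n → ℚ} {c : ℚ} {x : ℝ} (hx : x ^ 2 ≤ c)
    (hc : c ≤ sqDist u v) : x ≤ dist (euclPoint u) (euclPoint v) := by
  rw [dist_euclPoint]
  exact Real.le_sqrt_of_sq_le (hx.trans (by exact_mod_cast hc))

theorem coord_le_sqDist {n : ℕ} (u v : Fin n → ℚ) (i : Fin n) : (u i - v i) ^ 2 ≤ sqDist u v :=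
  Finset.single_le_sum (f := fun i => (u i - v i) ^ 2) (fun _ _ => sq_nonneg _) (Finset.mem_univ i)

theorem centerPt_injective {n : ℕ} : Function.Injective (centerPt (n := n)) := by
  intro S T h
  ext i
  have := congrFun h i
  simp only [centerPt] at this
  split_ifs at this with h1 h2 h2 <;> simp_all

theorem unitPt_injective {n : ℕ} : Function.Injective (unitPt (n := n)) := by
  intro i j h
  have := congrFun h i
  simp only [unitPt, if_true] at this
  by_contra hij
  simp [hij] at this

theorem unitPt_ne_zero {n : ℕ} (i : Fin n) : unitPt i ≠ 0 := fun h => by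
  have := congrFun h i
  simp [unitPt] at this

theorem centerPt_ne_zero {n : ℕ} {S : Finset (Fin n)} (hS : S.card = 3) : centerPt S ≠ 0 := fun h => by
  obtain ⟨i, hi⟩ := Finset.card_pos.mp (by omega : 0 < S.card)
  have := congrFun h i
  simp [centerPt, hi] at this

theorem unitPt_ne_centerPt {n : ℕ} (i : Fin n) (S : Finset (Fin n)) : unitPt i ≠ centerPt S :=
  fun h => by
    have := congrFun h i
    simp only [unitPt, centerPt, if_true] at this
    split_ifs at this <;> norm_num at this

theorem sqDist_unitPt_zero {n : ℕ} (i : Fin n) : sqDist (unitPt i) 0 = 1 := by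
  simp [sqDist, unitPt]

theorem one_le_sqDist_unitPt {n : ℕ} {i : Fin n} {u : Fin n → ℚ} (h : u i = 0) :
    1 ≤ sqDist (unitPt i) u := by
  refine le_trans ?_ (coord_le_sqDist _ _ i)
  simp [unitPt, h]

theorem sqDist_centerPt_zero {n : ℕ} {S : Finset (Fin n)} (hS : S.card = 3) :
    sqDist (centerPt S) 0 = 1 / 12 := by
  simp [sqDist, centerPt, ite_pow, hS]
  norm_num

theorem sqDist_unitPt_centerPt {n : ℕ} {S : Finset (Fin n)} (hS : S.card = 3) {i : Fin n}
    (hi : i ∈ S) : sqDist (unitPt i) (centerPt S) = 3 / 4 := by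
  have h : ∀ j, (unitPt i j - centerPt S j) ^ 2 =
      (if j = i then 2 / 3 else 0) + (if j ∈ S then (1 / 36 : ℚ) else 0) := by
    intro j
    by_cases hj : j = i
    · subst hj; simp [unitPt, centerPt, hi]; norm_num
    · by_cases hjS : j ∈ S <;> simp [unitPt, centerPt, hj, hjS]; norm_num
  simp only [sqDist, h, Finset.sum_add_distrib]
  simp [hS]
  norm_num

theorem sqDist_centerPt_centerPt {n : ℕ} {S T : Finset (Fin n)} (h : S.card = T.card) :
    sqDist (centerPt S) (centerPt T) = (S \ T).card / 18 := by
  have h1 : ∀ j, (centerPt S j - centerPt T j) ^ 2 =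
      (if j ∈ S \ T then 1 / 36 else 0) + (if j ∈ T \ S then (1 / 36 : ℚ) else 0) := by
    intro j
    by_cases hS : j ∈ S <;> by_cases hT : j ∈ T <;> simp [centerPt, hS, hT] <;> norm_num
  have h2 : (T \ S).card = (S \ T).card := by
    rw [Finset.card_sdiff_comm h.symm]
  simp only [sqDist, h1, Finset.sum_add_distrib, Finset.sum_ite_mem, Finset.univ_inter,
    Finset.sum_const, nsmul_eq_mul, h2]
  ring

/-- The lengths of the edges to the parents of a facility `S` and of its elements in `K` save at
most what they save in the star in which `K = S`. -/
theorem card_le_dist_centerPt {n : ℕ} {S K : Finset (Fin n)} (hS : S.card = 3) (hK : K ⊆ S)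
    {u : Fin n → ℚ}
    (hu : u = 0 ∨ (∃ j, u = unitPt j) ∨ ∃ T : Finset (Fin n), T.card = 3 ∧ Disjoint K T ∧
      u = centerPt T) :
    (K.card : ℝ) ≤ dist (euclPoint (centerPt S)) (euclPoint u) + K.card * (Real.sqrt 3 / 2) +
      (if K.card = 3 then 3 * saving else 0) := by
  have h3 := Real.sq_sqrt (show (0 : ℝ) ≤ 3 by norm_num)
  have h30 := Real.sqrt_nonneg 3
  -- The origin is at squared distance 1/12 and every unit vector at no less than 25/36. A facility
  -- T disjoint from K has |S \ T| ≥ |K|, and its squared distance is |S \ T|/18.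
  have key : min (1 / 12) (K.card / 18 : ℚ) ≤ sqDist (centerPt S) u := by
    rcases hu with rfl | ⟨j, rfl⟩ | ⟨T, hT, hd, rfl⟩
    · rw [sqDist_centerPt_zero hS]
      exact min_le_left _ _
    · refine (min_le_left _ _).trans (le_trans ?_ (coord_le_sqDist _ _ j))
      by_cases hj : j ∈ S <;> simp [centerPt, unitPt, hj] <;> norm_num
    · refine (min_le_right _ _).trans ?_
      rw [sqDist_centerPt_centerPt (hS.trans hT.symm)]
      have : K.card ≤ (S \ T).card := Finset.card_le_card fun i hi =>
        Finset.mem_sdiff.mpr ⟨hK hi, fun h => Finset.disjoint_left.mp hd hi h⟩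
      have : (K.card : ℚ) ≤ (S \ T).card := by exact_mod_cast this
      linarith
  have hle : K.card ≤ 3 := hS ▸ Finset.card_le_card hK
  have hd : 0 ≤ dist (euclPoint (centerPt S)) (euclPoint u) := dist_nonneg
  obtain h | h | h | h : K.card = 0 ∨ K.card = 1 ∨ K.card = 2 ∨ K.card = 3 := by omega
  · simp [h]
  -- The element saves at most 1 - √3/2 ≈ 0.134, which is less than 1/6.
  · rw [h] at key
    have := le_dist_euclPoint (x := 1 / 6) (c := 1 / 36) (by norm_num)
      (le_trans (by norm_num) key)
    norm_num [h]
    nlinarith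
  -- Since 2/18 > 1/12, the edge has length at least √3/6 ≈ 0.289, while two elements save at most 2
  -- - √3 ≈ 0.268.
  · rw [h] at key
    have := le_dist_euclPoint (x := Real.sqrt 3 / 6) (c := 1 / 12) (by push_cast; nlinarith)
      (le_trans (by norm_num) key)
    norm_num [h]
    nlinarith
  -- Here the inequality is tight for an edge to the origin: 3 - 3√3/2 - √3/6 = 3·`saving`.
  · rw [h] at key
    have := le_dist_euclPoint (x := Real.sqrt 3 / 6) (c := 1 / 12) (by push_cast; nlinarith)
      (le_trans (by norm_num) key)
    norm_num [h, saving]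
    nlinarith

/-! ### Steiner trees and packings -/

theorem SetSystem3.IsPacking.coverage_eq {I : SetSystem3} {C : Finset (Finset (Fin I.n))}
    (hC : I.IsPacking C) : coverage C = 3 * C.card := by
  rw [coverage, Finset.card_biUnion fun S hS T hT h => hC.2 hS hT h]
  simp only [id]
  rw [Finset.sum_const_nat (m := 3) fun S hS => I.card_eq S (List.mem_toFinset.mp (hC.1 hS)),
    mul_comm]

theorem coverage_le {n : ℕ} (C : Finset (Finset (Fin n))) : coverage C ≤ n :=
  (Finset.card_le_univ _).trans (Fintype.card_fin n).le

/-- The length of a pair of points. -/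
noncomputable def pairLength {d : ℕ} {Q : Finset (Fin d → ℚ)} : Sym2 ↥Q → ℝ :=
  Sym2.lift ⟨fun u v : ↥Q => dist (euclPoint u.1) (euclPoint v.1), fun _ _ => dist_comm _ _⟩

theorem pairLength_nonneg {d : ℕ} {Q : Finset (Fin d → ℚ)} (e : Sym2 ↥Q) : 0 ≤ pairLength e := by
  induction e with
  | h u v => exact dist_nonneg (x := euclPoint u.1) (y := euclPoint v.1)

/-- Every Steiner tree gives a packing whose star is not longer. -/
theorem SteinerTree.exists_isPacking {I : SetSystem3} {P X : Finset (Fin I.n → ℚ)}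
    (hP : ∀ v, v ∈ P ↔ v = 0 ∨ ∃ i, v = unitPt i)
    (hX : ∀ v, v ∈ X → ∃ S ∈ I.sets, v = centerPt S) (T : SteinerTree P X) :
    ∃ C, I.IsPacking C ∧ (I.n : ℝ) - saving * coverage C ≤ T.cost := by
  classical
  let V := ↥(P ∪ T.steiner)
  let r : V := ⟨0, Finset.mem_union_left _ ((hP _).mpr (Or.inl rfl))⟩
  let t : Fin I.n → V := fun i =>
    ⟨unitPt i, Finset.mem_union_left _ ((hP _).mpr (Or.inr ⟨i, rfl⟩))⟩
  obtain ⟨par, hpar, hsum⟩ :=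
    T.isTree.connected.exists_parent_sum_le r pairLength pairLength_nonneg
  have hcost : T.cost = ∑ e ∈ T.graph.edgeFinset, pairLength e := by
    unfold SteinerTree.cost pairLength
    congr!
  let Fs : Finset V := Finset.univ.filter fun v => v.1 ∈ T.steiner
  have hFs : ∀ v : V, v ∈ Fs → ∃ S ∈ I.sets, v.1 = centerPt S := fun v hv =>
    hX _ (T.steiner_subset (Finset.mem_filter.mp hv).2)
  have hclass : ∀ v : V, v.1 = 0 ∨ (∃ i, v.1 = unitPt i) ∨
      ∃ S : Finset (Fin I.n), S.card = 3 ∧ v.1 = centerPt S ∧ v ∈ Fs := by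
    intro v
    rcases Finset.mem_union.mp v.2 with h | h
    · rcases (hP _).mp h with h | h
      · exact Or.inl h
      · exact Or.inr (Or.inl h)
    · have hv : v ∈ Fs := Finset.mem_filter.mpr ⟨Finset.mem_univ _, h⟩
      obtain ⟨S, hS, hvS⟩ := hFs v hv
      exact Or.inr (Or.inr ⟨S, I.card_eq S hS, hvS, hv⟩)
  -- Vertices are bare points, so the set of a facility is recovered from its coordinates.
  let supp : V → Finset (Fin I.n) := fun v => Finset.univ.filter fun i => v.1 i = 1 / 6
  have hsupp : ∀ (v : V) (S : Finset (Fin I.n)), v.1 = centerPt S → supp v = S := by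
    intro v S h
    ext i
    simp [supp, h, centerPt]
  let U : Finset (Fin I.n) := Finset.univ.filter fun i => ∃ v ∈ Fs, i ∈ supp v
  -- Charging to a facility of least depth ensures that the parent of that facility, being nearer to
  -- the root, does not contain i. This gives the disjointness needed in `hfac`.
  have hσ : ∀ i ∈ U, ∃ v ∈ Fs, i ∈ supp v ∧
      ∀ u ∈ Fs, i ∈ supp u → T.graph.dist r v ≤ T.graph.dist r u := by
    intro i hi
    obtain ⟨v, hv, hiv⟩ := (Finset.mem_filter.mp hi).2
    obtain ⟨x, hx, hmin⟩ := Finset.exists_min_image (Fs.filter fun v => i ∈ supp v)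
      (T.graph.dist r) ⟨v, Finset.mem_filter.mpr ⟨hv, hiv⟩⟩
    exact ⟨x, (Finset.mem_filter.mp hx).1, (Finset.mem_filter.mp hx).2,
      fun u hu hiu => hmin u (Finset.mem_filter.mpr ⟨hu, hiu⟩)⟩
  have : Nonempty V := ⟨r⟩
  choose! σ hσF hσs hσmin using hσ
  let K : V → Finset (Fin I.n) := fun v => U.filter fun i => σ i = v
  have hKsupp : ∀ v, K v ⊆ supp v := by
    intro v i hi
    obtain ⟨hiU, rfl⟩ := Finset.mem_filter.mp hi
    exact hσs i hiU
  have hKsum : U.card = ∑ v ∈ Fs, (K v).card := Finset.card_eq_sum_card_fiberwise hσF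
  have hr : ∀ v ∈ Fs, v ≠ r := by
    rintro v hv rfl
    obtain ⟨S, hS, h⟩ := hFs _ hv
    exact centerPt_ne_zero (I.card_eq S hS) h.symm
  have htr : ∀ i, t i ≠ r := fun i h => unitPt_ne_zero i (congrArg Subtype.val h)
  have htF : ∀ i, t i ∉ Fs := fun i h => by
    obtain ⟨S, -, h⟩ := hFs _ h
    exact unitPt_ne_centerPt i S h
  have htinj : Function.Injective t := fun i j h => unitPt_injective (congrArg Subtype.val h)
  have hfac : ∀ v ∈ Fs, ((K v).card : ℝ) ≤ pairLength s(v, par v) +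
      (K v).card * (Real.sqrt 3 / 2) + (if (K v).card = 3 then 3 * saving else 0) := by
    intro v hv
    obtain ⟨S, hS, hvS⟩ := hFs v hv
    have hdist : pairLength s(v, par v) = dist (euclPoint (centerPt S)) (euclPoint (par v).1) := by
      rw [← hvS]; rfl
    rw [hdist]
    refine card_le_dist_centerPt (I.card_eq S hS) (hsupp v S hvS ▸ hKsupp v) ?_
    rcases hclass (par v) with h | h | ⟨R, hR, h, hF⟩
    · exact Or.inl h
    · exact Or.inr (Or.inl h)
    · refine Or.inr (Or.inr ⟨R, hR, Finset.disjoint_left.mpr fun i hi hiR => ?_, h⟩)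
      obtain ⟨hiU, rfl⟩ := Finset.mem_filter.mp hi
      have h1 := hσmin i hiU (par (σ i)) hF (by rw [hsupp _ R h]; exact hiR)
      have h2 := hpar _ (hr _ hv)
      omega
  -- Only a facility containing i is closer than 1 to the i-th unit vector, and then i is in U. The
  -- bound does not require the parent to be the facility to which i is charged.
  have hterm : ∀ i, (if i ∈ U then Real.sqrt 3 / 2 else 1) ≤ pairLength s(t i, par (t i)) := by
    intro i
    have h3 := Real.sq_sqrt (show (0 : ℝ) ≤ 3 by norm_num)
    have hone : ∀ u : Fin I.n → ℚ, u i = 0 →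
        (if i ∈ U then Real.sqrt 3 / 2 else 1) ≤ dist (euclPoint (unitPt i)) (euclPoint u) := by
      intro u hu
      refine le_dist_euclPoint (c := 1) ?_ (one_le_sqDist_unitPt hu)
      split_ifs
      · push_cast; nlinarith
      · norm_num
    change _ ≤ dist (euclPoint (unitPt i)) (euclPoint (par (t i)).1)
    rcases hclass (par (t i)) with h | ⟨j, h⟩ | ⟨R, hR, h, hF⟩
    · exact hone _ (by rw [h]; rfl)
    · refine hone _ ?_
      have hne : i ≠ j := by
        rintro rfl
        have h1 : par (t i) = t i := Subtype.ext h
        have h2 := hpar _ (htr i)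
        rw [h1] at h2
        exact lt_irrefl _ h2
      rw [h]
      exact if_neg hne
    · by_cases hi : i ∈ R
      · have hiU : i ∈ U := Finset.mem_filter.mpr
          ⟨Finset.mem_univ _, par (t i), hF, by rw [hsupp _ R h]; exact hi⟩
        rw [if_pos hiU, h]
        refine le_dist_euclPoint (c := 3 / 4) ?_ (sqDist_unitPt_centerPt hR hi).ge
        push_cast
        nlinarith
      · exact hone _ (by rw [h]; exact if_neg hi)
  -- All three elements of these facilities are charged to them, so their sets are fibres of σ and
  -- hence disjoint.
  let F3 : Finset V := Fs.filter fun v => (K v).card = 3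
  have hK3 : ∀ v ∈ F3, supp v = K v := by
    intro v hv
    obtain ⟨hvF, hv3⟩ := Finset.mem_filter.mp hv
    obtain ⟨S, hS, hvS⟩ := hFs v hvF
    refine (Finset.eq_of_subset_of_card_le (hKsupp v) ?_).symm
    rw [hsupp v S hvS, I.card_eq S hS, hv3]
  have hKdisj : ∀ u v : V, u ≠ v → Disjoint (K u) (K v) := fun u v huv =>
    Finset.disjoint_left.mpr fun i hu hv =>
      huv ((Finset.mem_filter.mp hu).2.symm.trans (Finset.mem_filter.mp hv).2)
  have hpack : I.IsPacking (F3.image supp) := by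
    constructor
    · intro S hS
      obtain ⟨v, hv, rfl⟩ := Finset.mem_image.mp hS
      obtain ⟨R, hR, hvR⟩ := hFs v (Finset.mem_filter.mp hv).1
      rw [hsupp v R hvR]
      exact List.mem_toFinset.mpr hR
    · intro A hA B hB hAB
      obtain ⟨u, hu, rfl⟩ := Finset.mem_image.mp (Finset.mem_coe.mp hA)
      obtain ⟨v, hv, rfl⟩ := Finset.mem_image.mp (Finset.mem_coe.mp hB)
      change Disjoint (supp u) (supp v)
      rw [hK3 u hu, hK3 v hv]
      exact hKdisj u v fun h => hAB (by rw [h])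
  have hcov : coverage (F3.image supp) = 3 * F3.card := by
    rw [hpack.coverage_eq, Finset.card_image_of_injOn]
    intro u hu v hv huv
    by_contra hne
    have h1 := hKdisj u v hne
    rw [← hK3 u hu, ← hK3 v hv, show supp u = supp v from huv, disjoint_self, hK3 v hv] at h1
    have h2 := (Finset.mem_filter.mp (Finset.mem_coe.mp hv)).2
    rw [h1] at h2
    simp at h2
  refine ⟨F3.image supp, hpack, ?_⟩
  have hsplit : ∑ i, pairLength s(t i, par (t i)) + ∑ v ∈ Fs, pairLength s(v, par v) ≤ T.cost := by
    rw [hcost]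
    refine le_trans ?_ hsum
    rw [← Finset.sum_image (f := fun v => pairLength s(v, par v)) htinj.injOn, ← Finset.sum_union]
    · refine Finset.sum_le_sum_of_subset_of_nonneg ?_ fun _ _ _ => pairLength_nonneg _
      intro v hv
      refine Finset.mem_erase.mpr ⟨?_, Finset.mem_univ _⟩
      rcases Finset.mem_union.mp hv with h | h
      · obtain ⟨i, -, rfl⟩ := Finset.mem_image.mp h
        exact htr i
      · exact hr v h
    · refine Finset.disjoint_left.mpr fun v hv => ?_
      obtain ⟨i, -, rfl⟩ := Finset.mem_image.mp hv
      exact htF i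
  have h1 : (U.card : ℝ) * (Real.sqrt 3 / 2) + (I.n - U.card) ≤
      ∑ i, pairLength s(t i, par (t i)) := by
    refine le_trans (le_of_eq ?_) (Finset.sum_le_sum fun i _ => hterm i)
    rw [Finset.sum_ite, Finset.sum_const, Finset.sum_const, Finset.filter_mem_eq_inter,
      Finset.univ_inter, Finset.filter_not, Finset.filter_mem_eq_inter, Finset.univ_inter,
      Finset.card_sdiff_of_subset (Finset.subset_univ _), nsmul_eq_mul, nsmul_eq_mul, mul_one,
      Finset.card_univ, Nat.cast_sub (Finset.card_le_univ _), Fintype.card_fin]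
  -- Summing `hfac` over the facilities turns the sum of the |K| into |U|. Adding `h1` then cancels
  -- both terms in |U|.
  have h2 : (U.card : ℝ) ≤ ∑ v ∈ Fs, pairLength s(v, par v) + U.card * (Real.sqrt 3 / 2) +
      saving * (3 * F3.card) := by
    have h := Finset.sum_le_sum hfac
    rw [Finset.sum_add_distrib, Finset.sum_add_distrib, ← Finset.sum_mul, ← Finset.sum_filter,
      Finset.sum_const, nsmul_eq_mul, ← Nat.cast_sum, ← hKsum] at h
    calc _ ≤ _ := h
      _ = _ := by ring
  rw [hcov]
  push_cast
  linarith

/-- A packing gives a star that connects its sets to the root. -/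
theorem SetSystem3.IsPacking.exists_steinerTree {I : SetSystem3} {P X : Finset (Fin I.n → ℚ)}
    (hP : ∀ v, v ∈ P ↔ v = 0 ∨ ∃ i, v = unitPt i) (hX : ∀ S ∈ I.sets, centerPt S ∈ X)
    {C : Finset (Finset (Fin I.n))} (hC : I.IsPacking C) :
    ∃ T : SteinerTree P X, T.cost ≤ (I.n : ℝ) - saving * coverage C := by
  classical
  let Q := P ∪ C.image centerPt
  let r : ↥Q := ⟨0, Finset.mem_union_left _ ((hP _).mpr (Or.inl rfl))⟩
  let t : Fin I.n → ↥Q := fun i =>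
    ⟨unitPt i, Finset.mem_union_left _ ((hP _).mpr (Or.inr ⟨i, rfl⟩))⟩
  let fac : Finset (Fin I.n) → ↥Q := fun S =>
    if h : S ∈ C then ⟨centerPt S, Finset.mem_union_right _ (Finset.mem_image_of_mem _ h)⟩ else r
  have hfac : ∀ S ∈ C, (fac S).1 = centerPt S := fun S hS => by simp only [fac, dif_pos hS]
  have hcard : ∀ S ∈ C, S.card = 3 := fun S hS => I.card_eq S (List.mem_toFinset.mp (hC.1 hS))
  let U := C.biUnion id
  have hσ : ∀ i ∈ U, ∃ S ∈ C, i ∈ S := fun i hi => Finset.mem_biUnion.mp hi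
  choose! σ hσC hσi using hσ
  -- Covered elements hang from the facility of their set; facilities and uncovered elements hang
  -- from the origin.
  let par : ↥Q → ↥Q := fun v => if h : ∃ i, v.1 = unitPt i ∧ i ∈ U then fac (σ h.choose) else r
  have hpt : ∀ i ∈ U, par (t i) = fac (σ i) := by
    intro i hi
    have h : ∃ j, (t i).1 = unitPt j ∧ j ∈ U := ⟨i, rfl, hi⟩
    have hj : h.choose = i := (unitPt_injective h.choose_spec.1).symm
    simp only [par, dif_pos h, hj]
  have hpt' : ∀ i ∉ U, par (t i) = r := by
    intro i hi
    refine dif_neg ?_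
    rintro ⟨j, hj, hjU⟩
    exact hi (unitPt_injective hj ▸ hjU)
  have hpf : ∀ S ∈ C, par (fac S) = r := by
    intro S hS
    refine dif_neg ?_
    rintro ⟨j, hj, -⟩
    rw [hfac S hS] at hj
    exact unitPt_ne_centerPt j S hj.symm
  have hclass : ∀ v : ↥Q, v ≠ r → (∃ i, v = t i) ∨ ∃ S ∈ C, v = fac S := by
    intro v hv
    rcases Finset.mem_union.mp v.2 with h | h
    · rcases (hP _).mp h with h | ⟨i, h⟩
      · exact absurd (Subtype.ext h) hv
      · exact Or.inl ⟨i, Subtype.ext h⟩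
    · obtain ⟨S, hS, h⟩ := Finset.mem_image.mp h
      exact Or.inr ⟨S, hS, Subtype.ext (h.symm.trans (hfac S hS).symm)⟩
  -- Elements get depth 2 even when attached to the origin; only the decrease towards the parent
  -- matters.
  let depth : ↥Q → ℕ := fun v => if v.1 = 0 then 0 else if ∃ i, v.1 = unitPt i then 2 else 1
  have hdr : depth r = 0 := if_pos rfl
  have hdt : ∀ i, depth (t i) = 2 := fun i => by
    simp only [depth, t, if_neg (unitPt_ne_zero i)]
    exact if_pos ⟨i, rfl⟩
  have hdf : ∀ S ∈ C, depth (fac S) = 1 := fun S hS => by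
    simp only [depth, hfac S hS, if_neg (centerPt_ne_zero (hcard S hS))]
    exact if_neg fun ⟨i, h⟩ => unitPt_ne_centerPt i S h.symm
  have hdepth : ∀ v, v ≠ r → depth (par v) < depth v := by
    intro v hv
    rcases hclass v hv with ⟨i, rfl⟩ | ⟨S, hS, rfl⟩
    · by_cases hi : i ∈ U
      · rw [hpt i hi, hdt, hdf _ (hσC i hi)]; norm_num
      · rw [hpt' i hi, hdt, hdr]; norm_num
    · rw [hpf S hS, hdr, hdf S hS]; norm_num
  obtain ⟨G, hG, hsum⟩ :=
    SimpleGraph.exists_isTree_of_parent r par depth hdepth pairLength pairLength_nonneg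
  have hsub : C.image centerPt ⊆ X := by
    intro v hv
    obtain ⟨S, hS, rfl⟩ := Finset.mem_image.mp hv
    exact hX S (List.mem_toFinset.mp (hC.1 hS))
  refine ⟨⟨C.image centerPt, hsub, G, hG⟩, ?_⟩
  have hcost : SteinerTree.cost (P := P) (X := X) ⟨C.image centerPt, hsub, G, hG⟩ =
      ∑ e ∈ G.edgeFinset, pairLength e := by
    unfold SteinerTree.cost pairLength
    congr!
  rw [hcost]
  refine hsum.trans ?_
  have hle : ∑ v ∈ Finset.univ.erase r, pairLength s(v, par v) ≤
      ∑ i, pairLength s(t i, par (t i)) + ∑ S ∈ C, pairLength s(fac S, par (fac S)) := by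
    have hd : Disjoint (Finset.univ.image t) (C.image fac) := by
      refine Finset.disjoint_left.mpr fun v hv hv' => ?_
      obtain ⟨i, -, rfl⟩ := Finset.mem_image.mp hv
      obtain ⟨S, hS, h⟩ := Finset.mem_image.mp hv'
      exact unitPt_ne_centerPt i S ((congrArg Subtype.val h).symm.trans (hfac S hS))
    have hs : Finset.univ.erase r ⊆ Finset.univ.image t ∪ C.image fac := by
      intro v hv
      rw [Finset.mem_union, Finset.mem_image, Finset.mem_image]
      rcases hclass v (Finset.ne_of_mem_erase hv) with ⟨i, rfl⟩ | ⟨S, hS, rfl⟩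
      · exact Or.inl ⟨i, Finset.mem_univ _, rfl⟩
      · exact Or.inr ⟨S, hS, rfl⟩
    refine (Finset.sum_le_sum_of_subset_of_nonneg hs fun _ _ _ => pairLength_nonneg _).trans ?_
    rw [Finset.sum_union hd]
    exact add_le_add (Finset.sum_image_le_of_nonneg (f := fun v => pairLength s(v, par v))
        fun _ _ => pairLength_nonneg _)
      (Finset.sum_image_le_of_nonneg (f := fun v => pairLength s(v, par v))
        fun _ _ => pairLength_nonneg _)
  refine hle.trans ?_
  have h3 := Real.sq_sqrt (show (0 : ℝ) ≤ 3 by norm_num)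
  have hterm : ∀ i, pairLength s(t i, par (t i)) = if i ∈ U then Real.sqrt 3 / 2 else 1 := by
    intro i
    change dist (euclPoint (unitPt i)) (euclPoint (par (t i)).1) = _
    split_ifs with hi
    · rw [hpt i hi, hfac _ (hσC i hi), dist_euclPoint,
        sqDist_unitPt_centerPt (hcard _ (hσC i hi)) (hσi i hi)]
      rw [Real.sqrt_eq_iff_mul_self_eq (by norm_num) (by positivity)]
      push_cast
      nlinarith
    · rw [hpt' i hi, dist_euclPoint]
      change √((sqDist (unitPt i) 0 : ℚ) : ℝ) = 1
      rw [sqDist_unitPt_zero]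
      simp
  have hcen : ∀ S ∈ C, pairLength s(fac S, par (fac S)) = Real.sqrt 3 / 6 := by
    intro S hS
    change dist (euclPoint (fac S).1) (euclPoint (par (fac S)).1) = _
    rw [hpf S hS, hfac S hS, dist_euclPoint]
    change √((sqDist (centerPt S) 0 : ℚ) : ℝ) = _
    rw [sqDist_centerPt_zero (hcard S hS),
      Real.sqrt_eq_iff_mul_self_eq (by norm_num) (by positivity)]
    push_cast
    nlinarith
  have hU : (U.card : ℝ) = 3 * C.card := by exact_mod_cast hC.coverage_eq
  rw [Finset.sum_congr rfl fun i _ => hterm i, Finset.sum_congr rfl hcen, Finset.sum_ite,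
    Finset.sum_const, Finset.sum_const, Finset.sum_const, Finset.filter_mem_eq_inter,
    Finset.univ_inter, Finset.filter_not, Finset.filter_mem_eq_inter, Finset.univ_inter,
    Finset.card_sdiff_of_subset (Finset.subset_univ _), nsmul_eq_mul, nsmul_eq_mul, nsmul_eq_mul,
    mul_one, Finset.card_univ, Nat.cast_sub (Finset.card_le_univ _), Fintype.card_fin, hU,
    hC.coverage_eq, saving]
  push_cast
  linarith

/-! ### Running a machine for a bounded number of steps -/

/-- `f` leads from `a` to `b` in at most `m` steps. -/
def RunsIn {σ : Type*} (f : σ → Option σ) (a b : σ) (m : ℕ) : Prop :=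
  ∃ n ≤ m, (flip bind f)^[n] (some a) = some b

theorem RunsIn.mono {σ : Type*} {f : σ → Option σ} {a b : σ} {m m' : ℕ} (h : RunsIn f a b m)
    (hm : m ≤ m') : RunsIn f a b m' :=
  let ⟨n, hn, h⟩ := h
  ⟨n, hn.trans hm, h⟩

theorem RunsIn.congr_right {σ : Type*} {f : σ → Option σ} {a b b' : σ} {m : ℕ}
    (h : RunsIn f a b m) (hb : b = b') : RunsIn f a b' m :=
  hb ▸ h

theorem RunsIn.trans {σ : Type*} {f : σ → Option σ} {a b c : σ} {m m' : ℕ} (h : RunsIn f a b m)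
    (h' : RunsIn f b c m') : RunsIn f a c (m + m') := by
  obtain ⟨n, hn, h⟩ := h
  obtain ⟨n', hn', h'⟩ := h'
  exact ⟨n' + n, by omega, by rw [Function.iterate_add_apply, h, h']⟩

theorem RunsIn.step {σ : Type*} {f : σ → Option σ} {a b : σ} (h : f a = some b) :
    RunsIn f a b 1 :=
  ⟨1, le_rfl, h⟩

theorem RunsIn.head {σ : Type*} {f : σ → Option σ} {a b c : σ} {m : ℕ} (h : f a = some b)
    (h' : RunsIn f b c m) : RunsIn f a c (m + 1) :=
  ((RunsIn.step h).trans h').mono (by omega)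

theorem iterate_bind_none {σ : Type*} (f : σ → Option σ) (n : ℕ) :
    (flip bind f)^[n] (none : Option σ) = none := by
  induction n with
  | zero => rfl
  | succ n ih => rw [Function.iterate_succ_apply]; exact ih

/-- Running a machine inside another one. -/
theorem RunsIn.map {σ τ : Type*} {f : σ → Option σ} {g : τ → Option τ} (emb : σ → τ)
    (hemb : ∀ c c', f c = some c' → g (emb c) = some (emb c')) {a b : σ} {m : ℕ}
    (h : RunsIn f a b m) : RunsIn g (emb a) (emb b) m := by
  obtain ⟨n, hn, h⟩ := h
  refine ⟨n, hn, ?_⟩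
  clear hn
  induction n generalizing a with
  | zero => exact congrArg (Option.map emb) h
  | succ n ih =>
    rw [Function.iterate_succ_apply] at h ⊢
    change (flip bind f)^[n] (f a) = some b at h
    change (flip bind g)^[n] (g (emb a)) = _
    cases hfa : f a with
    | none => rw [hfa, iterate_bind_none] at h; cases h
    | some c => rw [hemb a c hfa]; rw [hfa] at h; exact ih h

/-- A quantity that grows by at most `C` in a step grows by at most `C m` in `m` steps. -/
theorem RunsIn.le_add_mul {σ : Type*} {f : σ → Option σ} (size : σ → ℕ) (C : ℕ)
    (hC : ∀ c c', f c = some c' → size c' ≤ size c + C) {a b : σ} {m : ℕ}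
    (h : RunsIn f a b m) : size b ≤ size a + C * m := by
  obtain ⟨n, hn, h⟩ := h
  refine le_trans ?_ (Nat.add_le_add_left (Nat.mul_le_mul_left C hn) _)
  clear hn
  induction n generalizing a with
  | zero => cases h; exact Nat.le_add_right _ _
  | succ n ih =>
    rw [Function.iterate_succ_apply] at h
    change (flip bind f)^[n] (f a) = some b at h
    cases hfa : f a with
    | none => rw [hfa, iterate_bind_none] at h; cases h
    | some c =>
      rw [hfa] at h
      have h1 := ih h
      have h2 := hC a c hfa
      rw [Nat.mul_succ]
      omega

namespace Turing

theorem TM2OutputsInTime.runsIn {tm : FinTM2} {l : List (tm.Γ tm.k₀)} {l' : List (tm.Γ tm.k₁)}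
    {m : ℕ} (h : TM2OutputsInTime tm l (some l') m) :
    RunsIn (TM2.step tm.m) (initList tm l) (haltList tm l') m :=
  ⟨h.steps, h.steps_le_m, h.evals_in_steps⟩

theorem _root_.RunsIn.tm2OutputsInTime {tm : FinTM2} {l : List (tm.Γ tm.k₀)}
    {l' : List (tm.Γ tm.k₁)} {m : ℕ}
    (h : RunsIn (TM2.step tm.m) (initList tm l) (haltList tm l') m) :
    Nonempty (TM2OutputsInTime tm l (some l') m) :=
  let ⟨n, hn, h⟩ := h
  ⟨⟨⟨n, h⟩, hn⟩⟩

/-- The stacks of which only one is nonempty. -/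
def singleStk {K : Type} [DecidableEq K] {Γ : K → Type} (k : K) (s : List (Γ k)) :
    ∀ k, List (Γ k) :=
  Function.update (fun _ => []) k s

theorem initList_eq (tm : FinTM2) (s : List (tm.Γ tm.k₀)) :
    initList tm s = ⟨some tm.main, tm.initialState, singleStk tm.k₀ s⟩ := by
  unfold initList singleStk
  congr 1
  funext k
  by_cases h : k = tm.k₀
  · subst h; simp
  · simp [h]

theorem haltList_eq (tm : FinTM2) (s : List (tm.Γ tm.k₁)) :
    haltList tm s = ⟨none, tm.initialState, singleStk tm.k₁ s⟩ := by
  unfold haltList singleStk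
  congr 1
  funext k
  by_cases h : k = tm.k₁
  · subst h; simp
  · simp [h]

/-- The number of push instructions in a statement. -/
def TM2.Stmt.pushes {K : Type} {Γ : K → Type} {Λ σ : Type} : TM2.Stmt Γ Λ σ → ℕ
  | .push _ _ q => q.pushes + 1
  | .peek _ _ q => q.pushes
  | .pop _ _ q => q.pushes
  | .load _ q => q.pushes
  | .branch _ q₁ q₂ => q₁.pushes + q₂.pushes
  | .goto _ => 0
  | .halt => 0

/-- Only pushes lengthen a stack, each by one letter. Counting both arms of a branch, and pushes on
all stacks, overestimates this. -/
theorem TM2.length_stepAux_le {K : Type} [DecidableEq K] {Γ : K → Type} {Λ σ : Type}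
    (q : TM2.Stmt Γ Λ σ) (v : σ) (S : ∀ k, List (Γ k)) (k : K) :
    ((TM2.stepAux q v S).stk k).length ≤ (S k).length + q.pushes := by
  induction q generalizing v S with
  | push k' f q ih =>
    refine (ih _ _).trans ?_
    by_cases h : k = k'
    · subst h; simp [TM2.Stmt.pushes]; omega
    · simp [TM2.Stmt.pushes, h]
  | peek k' f q ih => exact ih _ _
  | pop k' f q ih =>
    refine (ih _ _).trans ?_
    by_cases h : k = k'
    · subst h; simp [TM2.Stmt.pushes]
    · simp [TM2.Stmt.pushes, h]
  | load f q ih => exact ih _ _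
  | branch f q₁ q₂ ih₁ ih₂ =>
    have h1 := ih₁ v S
    have h2 := ih₂ v S
    simp only [TM2.stepAux, TM2.Stmt.pushes]
    cases f v
    · simp only [cond_false]; omega
    · simp only [cond_true]; omega
  | goto f => exact Nat.le_add_right _ _
  | halt => exact Nat.le_add_right _ _

/-- The output of a machine is not longer than the input plus a constant times the running time. -/
theorem FinTM2.exists_output_le (tm : FinTM2) : ∃ C : ℕ, ∀ (l : List (tm.Γ tm.k₀))
    (l' : List (tm.Γ tm.k₁)) (m : ℕ),
    RunsIn (TM2.step tm.m) (initList tm l) (haltList tm l') m → l'.length ≤ l.length + C * m := by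
  let _ := tm.ΛFin
  refine ⟨∑ x : tm.Λ, (tm.m x).pushes, fun l l' m h => ?_⟩
  have h1 := h.le_add_mul (fun c => (c.stk tm.k₁).length) (∑ x : tm.Λ, (tm.m x).pushes) ?_
  · rw [initList_eq, haltList_eq] at h1
    refine le_trans (le_of_eq ?_) (h1.trans (Nat.add_le_add_right ?_ _))
    · simp [singleStk]
    -- Input and output may share a stack. As the alphabet depends on the stack, the equation is
    -- applied to a general index.
    · by_cases hk : tm.k₁ = tm.k₀
      · have : ∀ (k : tm.K) (_ : k = tm.k₀), (singleStk tm.k₀ l k).length ≤ l.length := by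
          rintro _ rfl
          simp [singleStk]
        exact this _ hk
      · simp [singleStk, hk]
  · rintro ⟨x, v, S⟩ c' hc
    cases x with
    | none => cases hc
    | some x =>
      cases hc
      refine (TM2.length_stepAux_le _ _ _ _).trans (Nat.add_le_add_left ?_ _)
      exact Finset.single_le_sum (f := fun x => (tm.m x).pushes) (fun _ _ => Nat.zero_le _)
        (Finset.mem_univ x)

/-! ### Composition of machines -/

section Comp

variable (tm₁ tm₂ : FinTM2) (e : tm₁.Γ tm₁.k₁ → tm₂.Γ tm₂.k₀) (d : tm₂.Γ tm₂.k₀)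

/-- The stack alphabets of the composed machine, which has one more stack to copy the output of
the first machine to the input of the second. -/
def CompΓ : tm₁.K ⊕ tm₂.K ⊕ Unit → Type
  | .inl k => tm₁.Γ k
  | .inr (.inl k) => tm₂.Γ k
  | .inr (.inr _) => tm₂.Γ tm₂.k₀

/-- The labels of the composed machine. -/
abbrev CompΛ : Type := (tm₁.Λ ⊕ tm₂.Λ) ⊕ Bool

/-- The states of the composed machine. -/
abbrev Compσ : Type := (tm₁.σ × tm₂.σ) × Option (tm₂.Γ tm₂.k₀)

variable {tm₁ tm₂}

/-- The stacks of the composed machine. -/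
def compStk (S₁ : ∀ k, List (tm₁.Γ k)) (S₂ : ∀ k, List (tm₂.Γ k)) (A : List (tm₂.Γ tm₂.k₀)) :
    ∀ k, List (CompΓ tm₁ tm₂ k)
  | .inl k => S₁ k
  | .inr (.inl k) => S₂ k
  | .inr (.inr _) => A

theorem update_compStk_inl (S₁ : ∀ k, List (tm₁.Γ k)) (S₂ : ∀ k, List (tm₂.Γ k))
    (A : List (tm₂.Γ tm₂.k₀)) (k : tm₁.K) (x : List (CompΓ tm₁ tm₂ (.inl k))) :
    Function.update (compStk S₁ S₂ A) (.inl k) x = compStk (Function.update S₁ k x) S₂ A := by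
  funext k'
  rcases k' with k' | k' | k'
  · by_cases h : k' = k
    · subst h
      exact (Function.update_self _ _ _).trans (Function.update_self k' _ S₁).symm
    · exact (Function.update_of_ne (fun h' => h (Sum.inl_injective h')) _ _).trans
        (Function.update_of_ne h _ S₁).symm
  · exact Function.update_of_ne (by simp) _ _
  · exact Function.update_of_ne (by simp) _ _

theorem update_compStk_inr (S₁ : ∀ k, List (tm₁.Γ k)) (S₂ : ∀ k, List (tm₂.Γ k))
    (A : List (tm₂.Γ tm₂.k₀)) (k : tm₂.K) (x : List (CompΓ tm₁ tm₂ (.inr (.inl k)))) :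
    Function.update (compStk S₁ S₂ A) (.inr (.inl k)) x =
      compStk S₁ (Function.update S₂ k x) A := by
  funext k'
  rcases k' with k' | k' | k'
  · exact Function.update_of_ne (by simp) _ _
  · by_cases h : k' = k
    · subst h
      exact (Function.update_self _ _ _).trans (Function.update_self k' _ S₂).symm
    · exact (Function.update_of_ne (fun h' => h (Sum.inl_injective (Sum.inr_injective h'))) _
        _).trans (Function.update_of_ne h _ S₂).symm
  · exact Function.update_of_ne (by simp) _ _

theorem update_compStk_aux (S₁ : ∀ k, List (tm₁.Γ k)) (S₂ : ∀ k, List (tm₂.Γ k))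
    (A : List (tm₂.Γ tm₂.k₀)) (x : List (CompΓ tm₁ tm₂ (.inr (.inr ())))) :
    Function.update (compStk S₁ S₂ A) (.inr (.inr ())) x = compStk S₁ S₂ x := by
  funext k'
  rcases k' with k' | k' | k'
  · exact Function.update_of_ne (by simp) _ _
  · exact Function.update_of_ne (by simp) _ _
  · exact Function.update_self _ _ _

/-- A statement of the first machine as a statement of the composed machine. -/
def liftFst : TM2.Stmt tm₁.Γ tm₁.Λ tm₁.σ → TM2.Stmt (CompΓ tm₁ tm₂) (CompΛ tm₁ tm₂) (Compσ tm₁ tm₂)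
  | .push k f q => .push (.inl k) (fun s => f s.1.1) (liftFst q)
  | .peek k f q => .peek (.inl k) (fun s x => ((f s.1.1 x, s.1.2), s.2)) (liftFst q)
  | .pop k f q => .pop (.inl k) (fun s x => ((f s.1.1 x, s.1.2), s.2)) (liftFst q)
  | .load f q => .load (fun s => ((f s.1.1, s.1.2), s.2)) (liftFst q)
  | .branch f q₁ q₂ => .branch (fun s => f s.1.1) (liftFst q₁) (liftFst q₂)
  | .goto f => .goto fun s => .inl (.inl (f s.1.1))
  | .halt => .goto fun _ => .inr false

/-- A statement of the second machine as a statement of the composed machine. -/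
def liftSnd : TM2.Stmt tm₂.Γ tm₂.Λ tm₂.σ → TM2.Stmt (CompΓ tm₁ tm₂) (CompΛ tm₁ tm₂) (Compσ tm₁ tm₂)
  | .push k f q => .push (.inr (.inl k)) (fun s => f s.1.2) (liftSnd q)
  | .peek k f q => .peek (.inr (.inl k)) (fun s x => ((s.1.1, f s.1.2 x), s.2)) (liftSnd q)
  | .pop k f q => .pop (.inr (.inl k)) (fun s x => ((s.1.1, f s.1.2 x), s.2)) (liftSnd q)
  | .load f q => .load (fun s => ((s.1.1, f s.1.2), s.2)) (liftSnd q)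
  | .branch f q₁ q₂ => .branch (fun s => f s.1.2) (liftSnd q₁) (liftSnd q₂)
  | .goto f => .goto fun s => .inl (.inr (f s.1.2))
  | .halt => .halt

/-- The program of the composed machine. -/
def compProgram : CompΛ tm₁ tm₂ → TM2.Stmt (CompΓ tm₁ tm₂) (CompΛ tm₁ tm₂) (Compσ tm₁ tm₂)
  | .inl (.inl l) => liftFst (tm₁.m l)
  | .inl (.inr l) => liftSnd (tm₂.m l)
  | .inr false => .pop (.inl tm₁.k₁) (fun s x => (s.1, x.map e))
      (.branch (fun s => s.2.isSome)
        (.push (.inr (.inr ())) (fun s => s.2.getD d) (.goto fun _ => .inr false))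
        (.goto fun _ => .inr true))
  | .inr true => .pop (.inr (.inr ())) (fun s x => (s.1, x))
      (.branch (fun s => s.2.isSome)
        (.push (.inr (.inl tm₂.k₀)) (fun s => s.2.getD d) (.goto fun _ => .inr true))
        (.goto fun _ => .inl (.inr tm₂.main)))

/-- The composed machine. -/
def compTM : FinTM2 where
  K := tm₁.K ⊕ tm₂.K ⊕ Unit
  kFin := letI := tm₁.kFin; letI := tm₂.kFin; inferInstance
  k₀ := .inl tm₁.k₀
  k₁ := .inr (.inl tm₂.k₁)
  Γ := CompΓ tm₁ tm₂
  Λ := CompΛ tm₁ tm₂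
  main := .inl (.inl tm₁.main)
  ΛFin := letI := tm₁.ΛFin; letI := tm₂.ΛFin; inferInstance
  σ := Compσ tm₁ tm₂
  initialState := ((tm₁.initialState, tm₂.initialState), none)
  σFin := letI := tm₁.σFin; letI := tm₂.σFin; letI := tm₂.Γk₀Fin; inferInstance
  Γk₀Fin := tm₁.Γk₀Fin
  m := compProgram e d

/-- A configuration of the first machine as a configuration of the composed machine. -/
def embFst (c : TM2.Cfg tm₁.Γ tm₁.Λ tm₁.σ) :
    TM2.Cfg (CompΓ tm₁ tm₂) (CompΛ tm₁ tm₂) (Compσ tm₁ tm₂) where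
  l := some (c.l.elim (.inr false) fun l => .inl (.inl l))
  var := ((c.var, tm₂.initialState), none)
  stk := compStk c.stk (fun _ => []) []

/-- A configuration of the second machine as a configuration of the composed machine. -/
def embSnd (c : TM2.Cfg tm₂.Γ tm₂.Λ tm₂.σ) :
    TM2.Cfg (CompΓ tm₁ tm₂) (CompΛ tm₁ tm₂) (Compσ tm₁ tm₂) where
  l := c.l.map fun l => .inl (.inr l)
  var := ((tm₁.initialState, c.var), none)
  stk := compStk (fun _ => []) c.stk []

/-- A lifted statement leaves the state and stacks of the other machine alone, so it commutes with
the embedding. Halting corresponds to the jump to the copying phase, which is how `embFst` treats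
the missing label. -/
theorem stepAux_liftFst (q : TM2.Stmt tm₁.Γ tm₁.Λ tm₁.σ) (v : tm₁.σ) (S : ∀ k, List (tm₁.Γ k)) :
    TM2.stepAux (liftFst q) ((v, tm₂.initialState), none) (compStk S (fun _ => []) []) =
      embFst (tm₂ := tm₂) (TM2.stepAux q v S) := by
  induction q generalizing v S with
  | push k f q ih =>
    simp only [liftFst, TM2.stepAux, update_compStk_inl]
    exact ih _ _
  | peek k f q ih => exact ih _ _
  | pop k f q ih =>
    simp only [liftFst, TM2.stepAux, update_compStk_inl]
    exact ih _ _
  | load f q ih => exact ih _ _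
  | branch f q₁ q₂ ih₁ ih₂ =>
    simp only [liftFst, TM2.stepAux]
    cases f v
    · exact ih₂ _ _
    · exact ih₁ _ _
  | goto f => rfl
  | halt => rfl

theorem stepAux_liftSnd (q : TM2.Stmt tm₂.Γ tm₂.Λ tm₂.σ) (v : tm₂.σ) (S : ∀ k, List (tm₂.Γ k)) :
    TM2.stepAux (liftSnd q) ((tm₁.initialState, v), none) (compStk (fun _ => []) S []) =
      embSnd (tm₁ := tm₁) (TM2.stepAux q v S) := by
  induction q generalizing v S with
  | push k f q ih =>
    simp only [liftSnd, TM2.stepAux, update_compStk_inr]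
    exact ih _ _
  | peek k f q ih => exact ih _ _
  | pop k f q ih =>
    simp only [liftSnd, TM2.stepAux, update_compStk_inr]
    exact ih _ _
  | load f q ih => exact ih _ _
  | branch f q₁ q₂ ih₁ ih₂ =>
    simp only [liftSnd, TM2.stepAux]
    cases f v
    · exact ih₂ _ _
    · exact ih₁ _ _
  | goto f => rfl
  | halt => rfl

theorem step_embFst (c c' : TM2.Cfg tm₁.Γ tm₁.Λ tm₁.σ) (h : TM2.step tm₁.m c = some c') :
    TM2.step (compProgram e d) (embFst c) = some (embFst (tm₂ := tm₂) c') := by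
  rcases c with ⟨_ | l, v, S⟩
  · cases h
  · cases h
    exact congrArg some (stepAux_liftFst _ _ _)

theorem step_embSnd (c c' : TM2.Cfg tm₂.Γ tm₂.Λ tm₂.σ) (h : TM2.step tm₂.m c = some c') :
    TM2.step (compProgram e d) (embSnd c) = some (embSnd (tm₁ := tm₁) c') := by
  rcases c with ⟨_ | l, v, S⟩
  · cases h
  · cases h
    exact congrArg some (stepAux_liftSnd _ _ _)

theorem update_singleStk {K : Type} [DecidableEq K] {Γ : K → Type} (k : K) (s s' : List (Γ k)) :
    Function.update (singleStk k s) k s' = singleStk k s' :=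
  Function.update_idem _ _ _

theorem singleStk_self {K : Type} [DecidableEq K] {Γ : K → Type} (k : K) (s : List (Γ k)) :
    singleStk k s k = s :=
  Function.update_self _ _ _

theorem singleStk_nil {K : Type} [DecidableEq K] {Γ : K → Type} (k : K) :
    singleStk k ([] : List (Γ k)) = fun _ => [] :=
  Function.update_eq_self k _

/-- A running configuration of the composed machine. -/
abbrev compCfg (l : CompΛ tm₁ tm₂) (v : Compσ tm₁ tm₂) (S : ∀ k, List (CompΓ tm₁ tm₂ k)) :
    TM2.Cfg (CompΓ tm₁ tm₂) (CompΛ tm₁ tm₂) (Compσ tm₁ tm₂) :=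
  ⟨some l, v, S⟩

/-- Moving the word to the auxiliary stack reverses it, and `runsIn_move_in` reverses it back. The
final failed pop resets the register to `none`; the default letter `d` is never pushed. -/
theorem runsIn_move_out (v : tm₁.σ × tm₂.σ) (s : List (tm₁.Γ tm₁.k₁)) (o : Option (tm₂.Γ tm₂.k₀))
    (A : List (tm₂.Γ tm₂.k₀)) :
    RunsIn (TM2.step (compProgram e d))
      ⟨some (.inr false), (v, o), compStk (singleStk tm₁.k₁ s) (fun _ => []) A⟩
      ⟨some (.inr true), (v, none),
        compStk (fun _ => []) (fun _ => []) ((s.map e).reverse ++ A)⟩ (s.length + 1) := by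
  induction s generalizing o A with
  | nil =>
    refine RunsIn.step ?_
    simp only [TM2.step, compProgram, TM2.stepAux, update_compStk_inl, compStk, singleStk_nil]
    exact congrArg (fun S => some (compCfg (.inr true) (v, none)
      (compStk S (fun _ => []) A))) (Function.update_eq_self tm₁.k₁ (fun _ => []))
  | cons x s ih =>
    have h := ih (some (e x)) (e x :: A)
    rw [List.map_cons, List.reverse_cons, List.append_assoc]
    refine RunsIn.head ?_ h
    simp only [TM2.step, compProgram, TM2.stepAux, update_compStk_inl, update_compStk_aux, compStk,
      singleStk_self]
    exact congrArg (fun S => some (compCfg (.inr false) (v, some (e x))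
      (compStk S (fun _ => []) (e x :: A)))) (update_singleStk _ _ _)

theorem runsIn_move_in (v : tm₁.σ × tm₂.σ) (s : List (tm₂.Γ tm₂.k₀)) (o : Option (tm₂.Γ tm₂.k₀))
    (A : List (tm₂.Γ tm₂.k₀)) :
    RunsIn (TM2.step (compProgram e d))
      ⟨some (.inr true), (v, o), compStk (fun _ => []) (singleStk tm₂.k₀ s) A⟩
      ⟨some (.inl (.inr tm₂.main)), (v, none),
        compStk (tm₁ := tm₁) (fun _ => []) (singleStk tm₂.k₀ (A.reverse ++ s)) []⟩
      (A.length + 1) := by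
  induction A generalizing o s with
  | nil =>
    refine RunsIn.step ?_
    simp only [TM2.step, compProgram, TM2.stepAux, update_compStk_aux, compStk]
    rfl
  | cons x A ih =>
    have h := ih (x :: s) (some x)
    rw [List.reverse_cons, List.append_assoc]
    refine RunsIn.head ?_ h
    simp only [TM2.step, compProgram, TM2.stepAux, update_compStk_aux, compStk, singleStk_self]
    refine (congrArg (fun S => some (compCfg (.inr true) (v, some x) S))
      (update_compStk_inr (fun _ => []) (singleStk tm₂.k₀ s) A tm₂.k₀ (x :: s))).trans ?_
    exact congrArg (fun S => some (compCfg (.inr true) (v, some x) (compStk (fun _ => []) S A)))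
      (update_singleStk _ _ _)

/-- The four runs fit together because a machine halts in its initial state with every stack empty
except the output. Nothing has to be cleaned up before the second machine starts. -/
theorem runsIn_compTM {l : List (tm₁.Γ tm₁.k₀)} {s : List (tm₁.Γ tm₁.k₁)}
    {s' : List (tm₂.Γ tm₂.k₁)} {m m' : ℕ}
    (h : RunsIn (TM2.step tm₁.m) (initList tm₁ l) (haltList tm₁ s) m)
    (h' : RunsIn (TM2.step tm₂.m) (initList tm₂ (s.map e)) (haltList tm₂ s') m') :
    RunsIn (TM2.step (compTM e d).m) (initList (compTM e d) l) (haltList (compTM e d) s')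
      (m + (s.length + 1) + (s.length + 1) + m') := by
  have h1 := h.map _ (step_embFst e d)
  have h2 := runsIn_move_out e d (tm₁.initialState, tm₂.initialState) s none []
  have h3 := runsIn_move_in e d (tm₁.initialState, tm₂.initialState) [] none (s.map e).reverse
  have h4 := h'.map _ (step_embSnd e d)
  rw [List.append_nil] at h2
  rw [List.append_nil, List.reverse_reverse, singleStk_nil, List.length_reverse,
    List.length_map] at h3
  have hi : initList (compTM e d) l = embFst (tm₂ := tm₂) (initList tm₁ l) := by
    refine (initList_eq (compTM e d) l).trans (.trans ?_ (congrArg embFst (initList_eq tm₁ l)).symm)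
    refine congrArg (TM2.Cfg.mk _ _) (.trans ?_
      (update_compStk_inl (tm₁ := tm₁) (tm₂ := tm₂) (fun _ => []) (fun _ => []) [] _ l))
    exact congrArg (fun S => Function.update S _ _) (by funext k; rcases k with k | k | k <;> rfl)
  have hh : haltList (compTM e d) s' = embSnd (tm₁ := tm₁) (haltList tm₂ s') := by
    refine (haltList_eq (compTM e d) s').trans (.trans ?_ (congrArg embSnd (haltList_eq tm₂ s')).symm)
    refine congrArg (TM2.Cfg.mk _ _) (.trans ?_
      (update_compStk_inr (tm₁ := tm₁) (tm₂ := tm₂) (fun _ => []) (fun _ => []) [] _ s'))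
    exact congrArg (fun S => Function.update S _ _) (by funext k; rcases k with k | k | k <;> rfl)
  rw [hi, hh]
  rw [haltList_eq] at h1
  rw [initList_eq] at h4
  exact ((h1.trans h2).trans h3).trans h4

end Comp

theorem polynomial_eval_mono (p : Polynomial ℕ) {m n : ℕ} (h : m ≤ n) : p.eval m ≤ p.eval n := by
  rw [Polynomial.eval_eq_sum_range, Polynomial.eval_eq_sum_range]
  exact Finset.sum_le_sum fun i _ => Nat.mul_le_mul_left _ (Nat.pow_le_pow_left h i)

/-- Functions that are computable in polynomial time compose. -/
theorem TM2ComputableInPolyTime.comp {α β γ αΓ βΓ γΓ : Type} [Inhabited βΓ] {eα : α → List αΓ}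
    {eβ : β → List βΓ} {eγ : γ → List γΓ} {f : α → β} {g : β → γ}
    (h₁ : TM2ComputableInPolyTime eα eβ f) (h₂ : TM2ComputableInPolyTime eβ eγ g) :
    Nonempty (TM2ComputableInPolyTime eα eγ (g ∘ f)) := by
  obtain ⟨C, hC⟩ := h₁.tm.exists_output_le
  let e : h₁.tm.Γ h₁.tm.k₁ → h₂.tm.Γ h₂.tm.k₀ :=
    fun x => h₂.inputAlphabet.symm (h₁.outputAlphabet x)
  -- This bounds the length of the intermediate word, hence both copying phases and the argument of
  -- the second running time.
  let size : Polynomial ℕ := Polynomial.X + Polynomial.C C * h₁.time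
  have hrun : ∀ a, RunsIn (TM2.step (compTM e (h₂.inputAlphabet.symm default)).m)
      (initList (compTM e (h₂.inputAlphabet.symm default))
        (List.map h₁.inputAlphabet.invFun (eα a)))
      (haltList (compTM e (h₂.inputAlphabet.symm default))
        (List.map h₂.outputAlphabet.invFun (eγ (g (f a)))))
      ((h₁.time + 2 * (size + 1) + h₂.time.comp size).eval (eα a).length) := by
    intro a
    have r1 := (h₁.outputsFun a).runsIn
    have r2 := (h₂.outputsFun (f a)).runsIn
    have hlen := hC _ _ _ r1
    rw [List.length_map, List.length_map] at hlen
    have he : (List.map h₁.outputAlphabet.invFun (eβ (f a))).map e =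
        List.map h₂.inputAlphabet.invFun (eβ (f a)) := by
      rw [List.map_map]
      refine List.map_congr_left fun x _ => ?_
      simp [e]
    rw [← he] at r2
    refine (runsIn_compTM e (h₂.inputAlphabet.symm default) r1 r2).mono ?_
    have hmono : h₂.time.eval (eβ (f a)).length ≤ h₂.time.eval (size.eval (eα a).length) := by
      refine polynomial_eval_mono _ ?_
      simpa [size] using hlen
    simp only [List.length_map, Polynomial.eval_add, Polynomial.eval_mul, Polynomial.eval_comp,
      Polynomial.eval_one, Polynomial.eval_ofNat]
    have : (eβ (f a)).length ≤ size.eval (eα a).length := by simpa [size] using hlen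
    omega
  exact ⟨{
    tm := compTM e (h₂.inputAlphabet.symm default)
    inputAlphabet := h₁.inputAlphabet
    outputAlphabet := h₂.outputAlphabet
    time := h₁.time + 2 * (size + 1) + h₂.time.comp size
    outputsFun := fun a => (hrun a).tm2OutputsInTime.some }⟩

end Turing

/-! ### The machine of the reduction -/

/-- The stacks: the input, which becomes the output, two work stacks and the reversed output. -/
inductive RedStk
  | inp
  | cnt
  | aux
  | rev
deriving DecidableEq

instance : Fintype RedStk :=
  ⟨{.inp, .cnt, .aux, .rev}, fun k => by cases k <;> decide⟩

/-- The labels: read the size, write a terminal, restore the work stack, write the facilities,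
write the size in binary by repeated halving, and reverse the output. -/
inductive RedLabel
  | read
  | row
  | back
  | fac
  | bits
  | half (p : Bool)
  | ret
  | out
deriving DecidableEq, Fintype

/-- The stack alphabets. -/
abbrev RedΓ : RedStk → Type := fun _ => Letter

/-- The states: the letter read last and a carry. -/
abbrev Redσ : Type := Option Letter × Bool

/-- The statements. -/
abbrev RedStmt : Type := Turing.TM2.Stmt RedΓ RedLabel Redσ

/-- Write a word. -/
def emit : List Letter → RedStmt → RedStmt
  | [], q => q
  | x :: l, q => .push .rev (fun _ => x) (emit l q)

/-- The code of a coordinate of a terminal. -/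
def coordCode : Bool → List Letter
  | true => [.bit true, .slash, .bit true, .comma]
  | false => [.slash, .bit true, .comma]

/-- The code of a coordinate of a facility, or of the end of the facility. -/
def facCode : Letter → List Letter
  | .bit true => [.bit true, .slash, .bit false, .bit true, .bit true, .comma]
  | .bit false => [.slash, .bit true, .comma]
  | _ => [.semi]

/-- Pop a letter into the state and branch on whether there was one. -/
def popCase (k : RedStk) (q₁ q₂ : RedStmt) : RedStmt :=
  .pop k (fun s x => (x, s.2)) (.branch (fun s => s.1.isSome) q₁ q₂)

/-- Push the letter that was read last. -/
def pushRead (k : RedStk) (q : RedStmt) : RedStmt :=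
  .push k (fun s => s.1.getD .hash) q

/-- The program. -/
def redProgram : RedLabel → RedStmt
  | .read => .pop .inp (fun s x => (x, s.2)) (.branch (fun s => s.1 = some (.bit true))
      (.push .cnt (fun _ => .bit false) (emit [.bit true] (.goto fun _ => .read)))
      (emit [.hash] (.goto fun _ => .row)))
  -- A shift register: the old carry is stored in place of the letter just read, which becomes the
  -- new carry.
  | .row => popCase .cnt
      (.push .aux (fun s => .bit s.2) (.load (fun s => (s.1, s.1 = some (.bit true)))
        (.branch (fun s => s.2) (emit (coordCode true) (.goto fun _ => .row))
          (emit (coordCode false) (.goto fun _ => .row)))))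
      (emit [.semi] (.goto fun _ => .back))
  | .back => popCase .aux (pushRead .cnt (.goto fun _ => .back))
      (.branch (fun s => s.2) (emit [.hash] (.goto fun _ => .fac)) (.goto fun _ => .row))
  | .fac => popCase .inp
      (.branch (fun s => s.1 = some (.bit true)) (emit (facCode (.bit true)) (.goto fun _ => .fac))
        (.branch (fun s => s.1 = some (.bit false))
          (emit (facCode (.bit false)) (.goto fun _ => .fac)) (emit [.semi] (.goto fun _ => .fac))))
      (emit [.hash] (.goto fun _ => .bits))
  -- Halving a unary number keeps every second letter; the parity left over is the next binary
  -- digit.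
  | .bits => popCase .cnt (.goto fun _ => .half true)
      (emit [.slash, .bit true] (.goto fun _ => .out))
  | .half true => popCase .cnt (pushRead .aux (.goto fun _ => .half false))
      (emit [.bit true] (.goto fun _ => .ret))
  | .half false => popCase .cnt (.goto fun _ => .half true)
      (emit [.bit false] (.goto fun _ => .ret))
  | .ret => popCase .aux (pushRead .cnt (.goto fun _ => .ret)) (.goto fun _ => .bits)
  | .out => popCase .rev (pushRead .inp (.goto fun _ => .out)) .halt

/-- The machine of the reduction. -/
def redTM : Turing.FinTM2 where
  K := RedStk
  k₀ := .inp
  k₁ := .inp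
  Γ := RedΓ
  Λ := RedLabel
  main := .read
  σ := Redσ
  -- The carry `true` is the 1 that will travel through the rows. The same state must be reached
  -- again on halting.
  initialState := (none, true)
  Γk₀Fin := inferInstanceAs (Fintype Letter)
  m := redProgram

/-- The contents of the stacks. -/
def redStk (I A B W : List Letter) : ∀ k, List (RedΓ k)
  | .inp => I
  | .cnt => A
  | .aux => B
  | .rev => W

/-- A configuration. -/
abbrev redCfg (l : RedLabel) (v : Redσ) (I A B W : List Letter) :
    Turing.TM2.Cfg RedΓ RedLabel Redσ :=
  ⟨some l, v, redStk I A B W⟩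

/-- The step function. -/
abbrev redStep := Turing.TM2.step redProgram

/-! ### Runs of the phases of the machine -/

theorem update_inp (I A B W x : List Letter) :
    Function.update (redStk I A B W) .inp x = redStk x A B W := by
  funext k; cases k <;> rfl

theorem update_cnt (I A B W x : List Letter) :
    Function.update (redStk I A B W) .cnt x = redStk I x B W := by
  funext k; cases k <;> rfl

theorem update_aux (I A B W x : List Letter) :
    Function.update (redStk I A B W) .aux x = redStk I A x W := by
  funext k; cases k <;> rfl

theorem update_rev (I A B W x : List Letter) :
    Function.update (redStk I A B W) .rev x = redStk I A B x := by
  funext k; cases k <;> rfl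

theorem stepAux_emit (l : List Letter) (q : RedStmt) (v : Redσ) (I A B W : List Letter) :
    Turing.TM2.stepAux (emit l q) v (redStk I A B W) =
      Turing.TM2.stepAux q v (redStk I A B (l.reverse ++ W)) := by
  induction l generalizing W with
  | nil => rfl
  | cons x l ih =>
    rw [emit, Turing.TM2.stepAux, update_rev, ih, List.reverse_cons, List.append_assoc]
    rfl

section Steps

attribute [local simp] redProgram popCase pushRead stepAux_emit update_inp update_cnt update_aux
  update_rev redStk coordCode facCode

/-- The size is stored as n letters `bit false`, which serve both as the zero row that starts the
terminals and as the unary number converted to binary at the end. -/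
theorem runsIn_read (n k : ℕ) (o : Option Letter) (R W : List Letter) :
    RunsIn redStep
      (redCfg .read (o, true) (List.replicate n (Letter.bit true) ++ Letter.hash :: R)
        (List.replicate k (Letter.bit false)) [] W)
      (redCfg .row (some Letter.hash, true) R (List.replicate (k + n) (Letter.bit false)) []
        ((List.replicate n (Letter.bit true) ++ [Letter.hash]).reverse ++ W)) (n + 1) := by
  induction n generalizing k o W with
  | zero => exact RunsIn.step (by simp)
  | succ n ih =>
    have h := ih (k + 1) (some (Letter.bit true)) (Letter.bit true :: W)
    rw [show k + 1 + n = k + (n + 1) by ring] at h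
    rw [show (List.replicate (n + 1) (Letter.bit true) ++ [Letter.hash]).reverse ++ W =
      (List.replicate n (Letter.bit true) ++ [Letter.hash]).reverse ++ Letter.bit true :: W by
        simp [List.replicate_succ]]
    refine RunsIn.head ?_ h
    simp [List.replicate_succ]

/-- The hypothesis `hu` expresses the shift: the carry c enters in front, the last bit z drops out,
and u is the next row. It lands reversed on the second work stack, to be restored by `runsIn_back`.
-/
theorem runsIn_row (l u : List Bool) (c z : Bool) (hu : c :: l = u ++ [z]) (o : Option Letter)
    (I B W : List Letter) :
    RunsIn redStep
      (redCfg .row (o, c) I (l.map Letter.bit) B W)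
      (redCfg .back (none, z) I [] ((u.map Letter.bit).reverse ++ B)
        ((l.flatMap coordCode ++ [Letter.semi]).reverse ++ W)) (l.length + 1) := by
  induction l generalizing u c o B W with
  | nil =>
    obtain ⟨rfl, rfl⟩ : u = [] ∧ c = z := by
      cases u <;> simp_all
    exact RunsIn.step (by simp)
  | cons x l ih =>
    obtain ⟨u, rfl, hu'⟩ : ∃ u', u = c :: u' ∧ x :: l = u' ++ [z] := by
      cases u with
      | nil => simp at hu
      | cons b u =>
        rw [List.cons_append, List.cons.injEq] at hu
        exact ⟨u, by rw [hu.1], hu.2⟩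
    refine RunsIn.head ?_ ((ih u x hu' (some (Letter.bit x)) (Letter.bit c :: B)
      ((coordCode x).reverse ++ W)).congr_right ?_)
    · cases x <;> simp
    · simp

theorem runsIn_back (l : List Letter) (o : Option Letter) (z : Bool) (I A W : List Letter) :
    RunsIn redStep (redCfg .back (o, z) I A l W)
      (if z then redCfg .fac (none, z) I (l.reverse ++ A) [] (Letter.hash :: W)
        else redCfg .row (none, z) I (l.reverse ++ A) [] W) (l.length + 1) := by
  induction l generalizing o A with
  | nil => cases z <;> exact RunsIn.step (by simp)
  | cons x l ih =>
    refine RunsIn.head (b := redCfg .back (some x, z) I (x :: A) l W) ?_ ((ih (some x) (x :: A)).congr_right ?_)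
    · simp
    · simp

theorem runsIn_fac (l : List Letter) (o : Option Letter) (A W : List Letter) :
    RunsIn redStep (redCfg .fac (o, true) l A [] W)
      (redCfg .bits (none, true) [] A [] ((l.flatMap facCode ++ [Letter.hash]).reverse ++ W))
      (l.length + 1) := by
  induction l generalizing o W with
  | nil => exact RunsIn.step (by simp)
  | cons x l ih =>
    refine RunsIn.head ?_ ((ih (some x) ((facCode x).reverse ++ W)).congr_right ?_)
    · rcases x with (_ | _) | _ | _ | _ | _ <;> simp
    · simp

/-- The invariant `hN` counts i completed pairs, possibly one unpaired letter, and m letters still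
to be read. -/
theorem runsIn_half (N m i : ℕ) (p : Bool) (hN : N = 2 * i + p.toNat + m) (o : Option Letter)
    (W : List Letter) :
    RunsIn redStep
      (redCfg (.half p) (o, true) [] (List.replicate m (Letter.bit false))
        (List.replicate i (Letter.bit false)) W)
      (redCfg .ret (none, true) [] [] (List.replicate (N / 2) (Letter.bit false)) (Letter.bit N.bodd :: W))
      (m + 1) := by
  induction m generalizing i p o with
  | zero =>
    cases p
    · obtain rfl : N = 2 * i := by simpa using hN
      exact RunsIn.step (by simp)
    · obtain rfl : N = 2 * i + 1 := by simpa using hN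
      exact RunsIn.step (by simp [Nat.add_div]; try omega)
  | succ m ih =>
    cases p
    · refine RunsIn.head ?_ (ih i true (by simp at hN ⊢; omega) (some (Letter.bit false)))
      simp [List.replicate_succ]
    · refine RunsIn.head ?_ (ih (i + 1) false (by simp at hN ⊢; omega) (some (Letter.bit false)))
      simp [List.replicate_succ]

theorem runsIn_ret (a b : ℕ) (o : Option Letter) (W : List Letter) :
    RunsIn redStep
      (redCfg .ret (o, true) [] (List.replicate a (Letter.bit false)) (List.replicate b (Letter.bit false)) W)
      (redCfg .bits (none, true) [] (List.replicate (a + b) (Letter.bit false)) [] W) (b + 1) := by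
  induction b generalizing a o with
  | zero => exact RunsIn.step (by simp)
  | succ b ih =>
    have h := ih (a + 1) (some (Letter.bit false))
    rw [show a + 1 + b = a + (b + 1) by ring] at h
    refine RunsIn.head ?_ h
    simp [List.replicate_succ]

theorem runsIn_bits (N : ℕ) (o : Option Letter) (W : List Letter) :
    RunsIn redStep
      (redCfg .bits (o, true) [] (List.replicate N (Letter.bit false)) [] W)
      (redCfg .out (none, true) [] [] []
        ((N.bits.map Letter.bit ++ [Letter.slash, Letter.bit true]).reverse ++ W)) ((N + 1) * (2 * N + 2)) := by
  induction N using Nat.strong_induction_on generalizing o W with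
  | _ N ih =>
    rcases Nat.eq_zero_or_pos N with rfl | hN
    · exact (RunsIn.step (by simp)).mono (by norm_num)
    · obtain ⟨M, rfl⟩ : ∃ M, N = M + 1 := ⟨N - 1, by omega⟩
      have h1 := runsIn_half (M + 1) M 0 true (by simp; omega) (some (Letter.bit false)) W
      have h2 := runsIn_ret 0 ((M + 1) / 2) none (Letter.bit (M + 1).bodd :: W)
      have h3 := ih ((M + 1) / 2) (by omega) none (Letter.bit (M + 1).bodd :: W)
      rw [Nat.zero_add] at h2
      have hb : (M + 1).bits = (M + 1).bodd :: ((M + 1) / 2).bits := by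
        -- The side condition excludes a leading zero: if half of the positive number M + 1
        -- vanishes, its last digit is 1.
        rw [← Nat.div2_val, ← Nat.bits_append_bit _ _ fun h => ?_, Nat.bit_bodd_div2]
        have := Nat.bodd_add_div2 (M + 1)
        rw [h] at this
        cases hb : (M + 1).bodd
        · rw [hb] at this; simp at this
        · rfl
      refine (RunsIn.head ?_ ((h1.trans h2).trans (h3.congr_right ?_))).mono ?_
      · simp [List.replicate_succ]
      · simp [hb]
      · have : (M + 1) / 2 ≤ M := by omega
        generalize (M + 1) / 2 = k at this
        have := Nat.mul_le_mul (show k + 1 ≤ M + 1 by omega) (show 2 * k + 2 ≤ 2 * M + 2 by omega)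
        nlinarith

theorem runsIn_out (l : List Letter) (o : Option Letter) (I : List Letter) :
    RunsIn redStep (redCfg .out (o, true) I [] [] l)
      ⟨none, (none, true), redStk (l.reverse ++ I) [] [] []⟩ (l.length + 1) := by
  induction l generalizing o I with
  | nil => exact RunsIn.step (by simp)
  | cons x l ih =>
    refine RunsIn.head (b := redCfg .out (some x, true) (x :: I) [] [] l) ?_ ((ih (some x) (x :: I)).congr_right ?_)
    · simp
    · simp

end Steps

/-- The coordinates of a terminal, as Booleans: all of them vanish except for the `j`-th one. -/
def rowBits (n j : ℕ) : List Bool := (List.range n).map fun i => decide (i + 1 = j)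

/-- The code of a terminal. -/
def rowCode (n j : ℕ) : List Letter := (rowBits n j).flatMap coordCode ++ [.semi]

theorem length_rowBits (n j : ℕ) : (rowBits n j).length = n := by simp [rowBits]

/-- Both sides are the 0-1 vector of length n + 1 whose only possible 1 is at position j, counted
from 0. Hence one shift leads from terminal j to terminal j + 1. -/
theorem cons_rowBits (n j : ℕ) :
    decide (j = 0) :: rowBits n j = rowBits n (j + 1) ++ [decide (j = n)] := by
  have h1 : (List.range (n + 1)).map (fun i => decide (i = j)) = decide (j = 0) :: rowBits n j := by
    rw [List.range_succ_eq_map, List.map_cons, List.map_map,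
      show decide (0 = j) = decide (j = 0) from decide_eq_decide.mpr eq_comm]
    rfl
  have h2 : (List.range (n + 1)).map (fun i => decide (i = j)) =
      rowBits n (j + 1) ++ [decide (j = n)] := by
    rw [List.range_succ, List.map_append,
      show decide (j = n) = decide (n = j) from decide_eq_decide.mpr eq_comm]
    simp [rowBits]
  rw [← h1, h2]

theorem map_rowBits_eq_replicate {n j : ℕ} (h : j = 0 ∨ n < j) :
    (rowBits n j).map Letter.bit = List.replicate n (Letter.bit false) := by
  refine List.eq_replicate_iff.mpr ⟨by simp [rowBits], ?_⟩
  intro x hx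
  simp only [rowBits, List.map_map, List.mem_map, List.mem_range, Function.comp] at hx
  obtain ⟨i, hi, rfl⟩ := hx
  rw [decide_eq_false (by omega)]

/-- The loop needs no counter: it ends when the 1 drops out of the row of terminal n, which leaves
the zero row behind. -/
theorem runsIn_rows (n m j : ℕ) (h : j + m = n) (o : Option Letter) (I W : List Letter) :
    RunsIn redStep
      (redCfg .row (o, decide (j = 0)) I ((rowBits n j).map Letter.bit) [] W)
      (redCfg .fac (none, true) I (List.replicate n (Letter.bit false)) []
        (((List.range' j (m + 1)).flatMap (rowCode n) ++ [Letter.hash]).reverse ++ W))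
      ((m + 1) * (2 * n + 2)) := by
  induction m generalizing j o W with
  | zero =>
    have h1 := runsIn_row _ _ _ _ (cons_rowBits n j) o I [] W
    have h2 := runsIn_back ((List.map Letter.bit (rowBits n (j + 1))).reverse ++ []) none
      (decide (j = n)) I [] ((rowCode n j).reverse ++ W)
    obtain rfl : j = n := h
    rw [decide_eq_true rfl] at h1 h2
    refine ((h1.trans h2).congr_right ?_).mono ?_
    · simp [map_rowBits_eq_replicate (n := j) (j := j + 1) (by omega)]
    · simp [length_rowBits]; omega
  | succ m ih =>
    have h1 := runsIn_row _ _ _ _ (cons_rowBits n j) o I [] W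
    have h2 := runsIn_back ((List.map Letter.bit (rowBits n (j + 1))).reverse ++ []) none
      (decide (j = n)) I [] ((rowCode n j).reverse ++ W)
    have h3 := ih (j + 1) (by omega) none ((rowCode n j).reverse ++ W)
    have hj : ¬j = n := by omega
    rw [decide_eq_false hj] at h1 h2
    rw [decide_eq_false (by omega)] at h3
    simp only [Bool.false_eq_true, if_false, List.append_nil, List.reverse_reverse] at h1 h2
    refine (((h1.trans h2).trans h3).congr_right ?_).mono ?_
    · rw [List.range'_succ (s := j)]
      simp
    · simp [length_rowBits]; nlinarith

/-- The output of the machine. -/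
def redOutput (n : ℕ) (R : List Letter) : List Letter :=
  List.replicate n (Letter.bit true) ++ Letter.hash ::
    ((List.range (n + 1)).flatMap (rowCode n) ++ Letter.hash :: (R.flatMap facCode ++ Letter.hash ::
      (n.bits.map Letter.bit ++ [Letter.slash, Letter.bit true])))

theorem runsIn_redOutput_reverse (n : ℕ) (R : List Letter) :
    RunsIn redStep
      (redCfg .read (none, true) (List.replicate n (Letter.bit true) ++ Letter.hash :: R) [] [] [])
      (redCfg .out (none, true) [] [] [] (redOutput n R).reverse)
      (5 * (n + 1 + R.length + 1) ^ 2) := by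
  have h1 := runsIn_read n 0 none R []
  have h2 := runsIn_rows n n 0 (by omega) (some Letter.hash) R
    ((List.replicate n (Letter.bit true) ++ [Letter.hash]).reverse ++ [])
  have h3 := fun W => runsIn_fac R none (List.replicate n (Letter.bit false)) W
  have h4 := fun W => runsIn_bits n none W
  rw [map_rowBits_eq_replicate (Or.inl rfl)] at h2
  rw [Nat.zero_add] at h1
  refine (((h1.trans h2).trans ((h3 _).trans (h4 _))).congr_right ?_).mono ?_
  · rw [redOutput, List.range_eq_range']
    simp
  · nlinarith

theorem exists_runsIn_redOutput : ∃ p : Polynomial ℕ, ∀ (n : ℕ) (R : List Letter),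
    RunsIn redStep
      (redCfg .read (none, true) (List.replicate n (Letter.bit true) ++ Letter.hash :: R) [] [] [])
      ⟨none, (none, true), redStk (redOutput n R) [] [] []⟩
      (p.eval (n + 1 + R.length)) := by
  let C := ∑ l : RedLabel, (redProgram l).pushes
  let t : Polynomial ℕ := 5 * (Polynomial.X + 1) ^ 2
  refine ⟨t + (Polynomial.C C * t + 1), fun n R => ?_⟩
  have h1 := runsIn_redOutput_reverse n R
  have h2 := runsIn_out (redOutput n R).reverse none []
  -- The output was pushed onto an empty stack within the given time, so its length, and with it the
  -- final reversal, is polynomially bounded.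
  have h3 : (redOutput n R).reverse.length ≤ 0 + C * (5 * (n + 1 + R.length + 1) ^ 2) := by
    refine h1.le_add_mul (fun c => (c.stk .rev).length) C ?_
    rintro ⟨_ | l, v, S⟩ c' hc
    · cases hc
    · cases hc
      refine (Turing.TM2.length_stepAux_le _ _ _ _).trans (Nat.add_le_add_left ?_ _)
      exact Finset.single_le_sum (f := fun l => (redProgram l).pushes) (fun _ _ => Nat.zero_le _)
        (Finset.mem_univ l)
  rw [List.reverse_reverse, List.append_nil] at h2
  refine (h1.trans h2).mono ?_
  simp [t] at h3 ⊢
  omega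

/-! ### The reduction -/

/-- The terminals of the reduction: the origin and the unit vectors. -/
def terminalPt (n j : ℕ) : Fin n → ℚ := fun i => if (i : ℕ) + 1 = j then 1 else 0

theorem terminalPt_zero (n : ℕ) : terminalPt n 0 = 0 := by
  funext i
  simp [terminalPt]

theorem terminalPt_succ {n : ℕ} (i : Fin n) : terminalPt n (i + 1) = unitPt i := by
  funext j
  simp [terminalPt, unitPt, Fin.ext_iff]

theorem terminalPt_cases {n j : ℕ} (hj : j < n + 1) :
    terminalPt n j = 0 ∧ j = 0 ∨ ∃ i : Fin n, terminalPt n j = unitPt i ∧ j = i + 1 := by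
  rcases j with _ | j
  · exact Or.inl ⟨terminalPt_zero n, rfl⟩
  · exact Or.inr ⟨⟨j, by omega⟩, terminalPt_succ ⟨j, by omega⟩, rfl⟩

theorem mem_terminals {n : ℕ} (v : Fin n → ℚ) :
    v ∈ (List.range (n + 1)).map (terminalPt n) ↔ v = 0 ∨ ∃ i, v = unitPt i := by
  rw [List.mem_map]
  constructor
  · rintro ⟨j, hj, rfl⟩
    rcases terminalPt_cases (List.mem_range.mp hj) with ⟨h, -⟩ | ⟨i, h, -⟩
    · exact Or.inl h
    · exact Or.inr ⟨i, h⟩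
  · rintro (rfl | ⟨i, rfl⟩)
    · exact ⟨0, by simp, terminalPt_zero n⟩
    · exact ⟨i + 1, by simp, terminalPt_succ i⟩

theorem nodup_terminals (n : ℕ) : ((List.range (n + 1)).map (terminalPt n)).Nodup := by
  refine List.Nodup.map_on ?_ List.nodup_range
  intro j hj k hk h
  rcases terminalPt_cases (List.mem_range.mp hj) with ⟨h1, rfl⟩ | ⟨i, h1, rfl⟩ <;>
    rcases terminalPt_cases (List.mem_range.mp hk) with ⟨h2, rfl⟩ | ⟨i', h2, rfl⟩
  · rfl
  · exact absurd (h2.symm.trans (h.symm.trans h1)) (unitPt_ne_zero i')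
  · exact absurd (h1.symm.trans (h.trans h2)) (unitPt_ne_zero i)
  · rw [unitPt_injective (h1.symm.trans (h.trans h2))]

/-- The instance of DST of a set system. -/
def SetSystem3.toDST (I : SetSystem3) : DSTInstance where
  dim := I.n
  terminals := (List.range (I.n + 1)).map (terminalPt I.n)
  facilities := I.sets.map centerPt
  terminals_ne_nil := by simp
  terminals_nodup := nodup_terminals I.n
  facilities_nodup := I.nodup.map centerPt_injective

/-- The reduction. -/
def SetSystem3.reduce (I : SetSystem3) : DSTInstance × {q : ℚ // 0 < q} :=
  ⟨I.toDST, ⟨I.n, by exact_mod_cast I.n_pos⟩⟩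

/-! ### The code of the reduced instance is what the machine writes -/

theorem encodeRat_zero : encodeRat 0 = [.slash, .bit true] := by
  simp [encodeRat]

theorem encodeRat_one : encodeRat 1 = [.bit true, .slash, .bit true] := by
  simp [encodeRat]

theorem encodeRat_one_sixth :
    encodeRat (1 / 6) = [.bit true, .slash, .bit false, .bit true, .bit true] := by
  have h1 : (1 / 6 : ℚ).num = 1 := by norm_num
  have h2 : (1 / 6 : ℚ).den = 6 := by norm_num
  have h3 : Nat.bits 6 = [false, true, true] := by
    rw [show 6 = 2 * 3 from rfl, Nat.bit0_bits 3 (by norm_num), show 3 = 2 * 1 + 1 from rfl,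
      Nat.bit1_bits, Nat.one_bits]
  rw [encodeRat, if_neg (by norm_num), h1, h2, h3]
  simp

theorem encodeRat_natCast (n : ℕ) :
    encodeRat n = n.bits.map Letter.bit ++ [.slash, .bit true] := by
  rw [encodeRat, if_neg (by simp)]
  simp

theorem ofFn_eq_map_range {α : Type*} {n : ℕ} (f : ℕ → α) :
    List.ofFn (fun i : Fin n => f i) = (List.range n).map f := by
  refine List.ext_getElem (by simp) fun i h1 h2 => by simp

theorem encodePoints_terminals (n m : ℕ) :
    encodePoints ((List.range m).map (terminalPt n)) = (List.range m).flatMap (rowCode n) := by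
  rw [encodePoints, List.flatMap_map]
  refine List.flatMap_congr fun j _ => ?_
  rw [rowCode, rowBits]
  congr 1
  rw [show List.ofFn (terminalPt n j) = _ from
    ofFn_eq_map_range fun k => if k + 1 = j then (1 : ℚ) else 0, List.flatMap_map, List.flatMap_map]
  refine List.flatMap_congr fun i _ => ?_
  by_cases h : i + 1 = j
  · simp [h, encodeRat_one, coordCode]
  · simp [h, encodeRat_zero, coordCode]

/-- The 0-1 incidence vectors make the translation letter by letter: a bit becomes the coordinate
1/6 or 0, and the end mark stays. -/
theorem encodePoints_facilities {n : ℕ} (l : List (Finset (Fin n))) :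
    encodePoints (l.map centerPt) =
      (l.flatMap fun S => (List.ofFn fun i => Letter.bit (decide (i ∈ S))) ++
        [Letter.semi]).flatMap facCode := by
  rw [encodePoints, List.flatMap_map, List.flatMap_assoc]
  refine List.flatMap_congr fun S _ => ?_
  rw [List.flatMap_append, List.ofFn_eq_map, List.ofFn_eq_map, List.flatMap_map, List.flatMap_map]
  congr 1
  refine List.flatMap_congr fun i _ => ?_
  by_cases h : i ∈ S
  · have := encodeRat_one_sixth
    simp [h, centerPt, facCode] at this ⊢
    simp [this]
  · simp [h, centerPt, facCode, encodeRat_zero]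

theorem encodeDST_reduce (I : SetSystem3) : encodeDST I.reduce = redOutput I.n
    (I.sets.flatMap fun S => (List.ofFn fun i => Letter.bit (decide (i ∈ S))) ++ [Letter.semi]) := by
  rw [encodeDST, redOutput, ← encodePoints_terminals, ← encodePoints_facilities,
    ← encodeRat_natCast]
  rfl

theorem reduce_computable :
    Nonempty (Turing.TM2ComputableInPolyTime SetSystem3.encode encodeDST SetSystem3.reduce) := by
  obtain ⟨p, hp⟩ := exists_runsIn_redOutput
  have hrun : ∀ I : SetSystem3, RunsIn (Turing.TM2.step redTM.m)
      (Turing.initList redTM (I.encode.map (Equiv.refl Letter).invFun))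
      (Turing.haltList redTM ((encodeDST I.reduce).map (Equiv.refl Letter).invFun))
      (p.eval I.encode.length) := by
    intro I
    have h := hp I.n
      (I.sets.flatMap fun S => (List.ofFn fun i => Letter.bit (decide (i ∈ S))) ++ [Letter.semi])
    have hlen : ∀ R : List Letter, (List.replicate I.n (Letter.bit true) ++ Letter.hash :: R).length
        = I.n + 1 + R.length := by intro R; simp; omega
    rw [← hlen, ← encodeDST_reduce] at h
    have hid : ∀ l : List Letter, l.map (Equiv.refl Letter).invFun = l := fun l => List.map_id l
    have hs : ∀ l : List Letter,
        Turing.singleStk (Γ := RedΓ) RedStk.inp l = redStk l [] [] [] := by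
      intro l
      funext k
      cases k <;> rfl
    have hi : Turing.initList redTM (I.encode.map (Equiv.refl Letter).invFun) =
        redCfg .read (none, true) I.encode [] [] [] :=
      (congrArg (Turing.initList redTM) (hid I.encode)).trans
        ((Turing.initList_eq redTM I.encode).trans (congrArg
          (Turing.TM2.Cfg.mk (Γ := RedΓ) (some RedLabel.read) (none, true)) (hs I.encode)))
    have hh : Turing.haltList redTM ((encodeDST I.reduce).map (Equiv.refl Letter).invFun) =
        ⟨none, (none, true), redStk (encodeDST I.reduce) [] [] []⟩ :=
      (congrArg (Turing.haltList redTM) (hid (encodeDST I.reduce))).trans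
        ((Turing.haltList_eq redTM (encodeDST I.reduce)).trans (congrArg
          (Turing.TM2.Cfg.mk (Γ := RedΓ) (Λ := RedLabel) none (none, true))
          (hs (encodeDST I.reduce))))
    exact (congrArg₂ (fun a b => RunsIn redStep a b (p.eval I.encode.length)) hi hh).mpr h
  exact ⟨{
    tm := redTM
    inputAlphabet := Equiv.refl Letter
    outputAlphabet := Equiv.refl Letter
    time := p
    outputsFun := fun I => (hrun I).tm2OutputsInTime.some }⟩

/-- The sets are distinct triples, so there are at most C(n,3) of them, against n + 1 terminals. -/
theorem SetSystem3.length_facilities_le (I : SetSystem3) :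
    I.toDST.facilities.length ≤ (Polynomial.X ^ 3 : Polynomial ℕ).eval I.toDST.terminals.length := by
  have h1 : I.toDST.facilities.length = I.sets.toFinset.card := by
    rw [List.toFinset_card_of_nodup I.nodup]
    exact List.length_map _
  have h2 : I.toDST.terminals.length = I.n + 1 := by simp [SetSystem3.toDST]
  have h3 : I.sets.toFinset ⊆ Finset.powersetCard 3 Finset.univ := fun S hS =>
    Finset.mem_powersetCard.mpr ⟨Finset.subset_univ _, I.card_eq S (List.mem_toFinset.mp hS)⟩
  rw [h1, h2, Polynomial.eval_pow, Polynomial.eval_X]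
  refine (Finset.card_le_card h3).trans ?_
  rw [Finset.card_powersetCard, Finset.card_univ, Fintype.card_fin]
  exact (Nat.choose_le_pow I.n 3).trans (Nat.pow_le_pow_left (Nat.le_succ _) 3)

/-! ### From gaps in coverage to gaps in cost -/

theorem SetSystem3.exists_tree_cost_le (I : SetSystem3) {C : Finset (Finset (Fin I.n))}
    (hC : I.IsPacking C) : ∃ T : I.toDST.Tree, T.cost ≤ (I.n : ℝ) - saving * coverage C := by
  refine hC.exists_steinerTree (fun v => List.mem_toFinset.trans (mem_terminals v)) fun S hS => ?_
  exact List.mem_toFinset.mpr (List.mem_map_of_mem hS)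

theorem SetSystem3.exists_packing_le_cost (I : SetSystem3) (T : I.toDST.Tree) :
    ∃ C, I.IsPacking C ∧ (I.n : ℝ) - saving * coverage C ≤ T.cost := by
  refine SteinerTree.exists_isPacking (fun v => List.mem_toFinset.trans (mem_terminals v))
    (fun v hv => ?_) T
  obtain ⟨S, hS, rfl⟩ := List.mem_map.mp (List.mem_toFinset.mp hv)
  exact ⟨S, hS, rfl⟩

/-- A gap in the costs of the instances of the reduction gives hardness of approximation. -/
theorem EuclideanDSTHardToApprox.of_reduce {a b κ γ : ℝ} (hκ : 0 < κ)
    (hyes : ∀ I : SetSystem3, I ∈ (gapSP3 a b).yes → ∃ T : I.toDST.Tree, T.cost ≤ κ * I.n)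
    (hno : ∀ I : SetSystem3, I ∈ (gapSP3 a b).no → ∀ T : I.toDST.Tree, γ * (κ * I.n) ≤ T.cost)
    (h : (gapSP3 a b).NPHard) : EuclideanDSTHardToApprox γ := by
  refine ⟨Polynomial.X ^ 3, κ, hκ, fun L hL => ?_⟩
  obtain ⟨f, ⟨hf⟩, hf1, hf2⟩ := h L hL
  obtain ⟨hr⟩ := reduce_computable
  have : Inhabited Letter := ⟨.hash⟩
  have hq : ∀ I : SetSystem3, ((I.reduce.2.1 : ℚ) : ℝ) = I.n := fun I => Rat.cast_natCast I.n
  refine ⟨SetSystem3.reduce ∘ f, hf.comp hr, fun x hx => ?_, fun x hx => ?_⟩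
  · refine ⟨(f x).length_facilities_le, ?_⟩
    obtain ⟨T, hT⟩ := hyes _ (hf1 x hx)
    exact ⟨T, hT.trans_eq (congrArg (κ * ·) (hq _).symm)⟩
  · refine ⟨(f x).length_facilities_le, fun T => ?_⟩
    exact (congrArg (fun x => γ * (κ * x)) (hq _)).trans_le (hno _ (hf2 x hx) T)

theorem EuclideanDSTHardToApprox.mono {γ γ' : ℝ} (h : γ' ≤ γ) (hγ : EuclideanDSTHardToApprox γ) :
    EuclideanDSTHardToApprox γ' := by
  obtain ⟨p, κ, hκ, hp⟩ := hγ
  refine ⟨p, κ, hκ, fun L hL => ?_⟩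
  obtain ⟨f, hf, hf1, hf2⟩ := hp L hL
  refine ⟨f, hf, hf1, fun x hx => ⟨(hf2 x hx).1, fun T => le_trans ?_ ((hf2 x hx).2 T)⟩⟩
  have hq : (0 : ℝ) < (f x).2.1 := by exact_mod_cast (f x).2.2
  exact mul_le_mul_of_nonneg_right h (by positivity)

/-- Coverage at least an gives cost at most (1 - a·`saving`)n, and coverage at most bn forces cost
at least (1 - b·`saving`)n. The first coefficient serves as unit κ when a ≤ 1, where it is positive.
-/
theorem EuclideanDSTHardToApprox.of_gapSP3 (a b : ℝ) (h : (gapSP3 a b).NPHard) :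
    EuclideanDSTHardToApprox ((1 - b * saving) / (1 - a * saving)) := by
  have hs := saving_pos
  have hs1 := saving_lt_one
  rcases le_or_gt a 1 with ha | ha
  · have hκ : 0 < 1 - a * saving := by nlinarith
    refine .of_reduce hκ (fun I hI => ?_) (fun I hI T => ?_) h
    · obtain ⟨C, hC, hcov⟩ := hI
      obtain ⟨T, hT⟩ := I.exists_tree_cost_le hC
      exact ⟨T, by nlinarith⟩
    · obtain ⟨C, hC, hT⟩ := I.exists_packing_le_cost T
      have hcov := hI C hC
      rw [← mul_assoc, div_mul_cancel₀ _ hκ.ne']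
      nlinarith
  · -- no set system has a packing that covers more than the universe
    set γ := (1 - b * saving) / (1 - a * saving)
    have hγ : 0 < |γ| + 1 := by positivity
    -- The quotient γ may now be any real number. Every cost is at least (1 - `saving`)n, so κ is
    -- chosen small enough that γκ ≤ 1 - `saving`.
    refine .of_reduce (κ := (1 - saving) / (|γ| + 1)) (div_pos (by linarith) hγ) (fun I hI => ?_)
      (fun I _ T => ?_) h
    · obtain ⟨C, -, hcov⟩ := hI
      have h1 : (coverage C : ℝ) ≤ I.n := by exact_mod_cast coverage_le C
      have h2 : (0 : ℝ) < I.n := by exact_mod_cast I.n_pos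
      nlinarith
    · obtain ⟨C, -, hT⟩ := I.exists_packing_le_cost T
      have h1 : (coverage C : ℝ) ≤ I.n := by exact_mod_cast coverage_le C
      have h2 : (0 : ℝ) < I.n := by exact_mod_cast I.n_pos
      have h3 : γ * ((1 - saving) / (|γ| + 1)) ≤ 1 - saving := by
        rw [mul_div_assoc', div_le_iff₀ hγ]
        nlinarith [le_abs_self γ]
      rw [← mul_assoc]
      nlinarith

theorem mainTheorem8 :
    (∀ a b : ℝ, b < a → (gapSP3 a b).NPHard →
      EuclideanDSTHardToApprox
        ((b * (5 * Real.sqrt 3 / 9 - 1) + 1) / (a * (5 * Real.sqrt 3 / 9 - 1) + 1))) ∧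
    (∀ ε : ℝ, 0 < ε →
      1 + 0.039 * ε ≤ 1 + ε * (9 * Real.sqrt 3 - 15) / 15 ∧
      ((gapSP3 1 (1 - ε)).NPHard →
        EuclideanDSTHardToApprox (1 + ε * (9 * Real.sqrt 3 - 15) / 15))) ∧
    ((gapSP3 0.979 0.969).NPHard → EuclideanDSTHardToApprox 1.00039) := by
  have h3 := Real.sq_sqrt (show (0 : ℝ) ≤ 3 by norm_num)
  have h30 : 0 < Real.sqrt 3 := by positivity
  have hlow : 1.73205 ≤ Real.sqrt 3 := Real.le_sqrt_of_sq_le (by norm_num)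
  have hup : Real.sqrt 3 ≤ 1.7321 := Real.sqrt_le_iff.mpr (by norm_num)
  refine ⟨fun a b _ h => ?_, fun ε hε => ⟨by nlinarith, fun h => ?_⟩, fun h => ?_⟩
  · have := EuclideanDSTHardToApprox.of_gapSP3 a b h
    convert this using 2 <;> rw [saving] <;> ring
  · have := EuclideanDSTHardToApprox.of_gapSP3 1 (1 - ε) h
    convert this using 1
    -- With s = `saving`, the factor is 1 + ε·s/(1 - s). As 1 - s = 5√3/9, the quotient s/(1 - s) is
    -- 3√3/5 - 1 = (9√3 - 15)/15.
    rw [saving, eq_div_iff (by linarith)]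
    nlinarith
  · refine (EuclideanDSTHardToApprox.of_gapSP3 0.979 0.969 h).mono ?_
    rw [saving, le_div_iff₀ (by linarith)]
    linarith
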